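/- Let $X$ be a compact connected Riemann surface, $f$ a holomorphic automorphism of $X$ of prime order $p$, and $\zeta$ a primitive $p$-th root of unity. An $\langle f\rangle$-equivariant holomorphic vector bundle is a holomorphic vector bundle $E$ with a holomorphic fibrewise linear lift $f_E:E\to E$ covering $f$, with $f_E^{\,p}=\mathrm{Id}$; at a fixed point $x$ of $f$ it gives $f_E(x)\in\mathrm{End}(E_x)$. Let $D$ be a finite set of fixed points of $f$. A (rank two) quasi-parabolic Higgs bundle $(E,F,\Phi)$ on $(X,D)$ is a rank two holomorphic vector bundle $E$ with a line $F_y\subset E_y$ for each $y\in D$ and a meromorphic section $\Phi$ of $\mathrm{End}_0(E)\otimes K_X$, holomorphic off $D$ and with at most simple poles on $D$, whose residue at each $y\in D$ maps $E_y$ into $F_y$ and $F_y$ to $0$. It is $\langle f\rangle$-equivariant if $E$ is, $f_E(F_y)=F_y$ for $y \in D$, and $f_E\circ\Phi_y(v)=\Phi_{f(y)}(df_y v)\circ f_E$ for all $y\in X\setminus D$, $v\in T_yX$. Morphisms are equivariant holomorphic bundle maps (over the identity of $X$) which send flags into flags and intertwine the Higgs fields off $D$. Let $L$ be an $\langle f\rangle$-equivariant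 line bundle on $X$, and let $(E,F,\Phi)$ be an $\langle f\rangle$-equivariant quasi-parabolic Higgs bundle on $(X,D)$ with $\det E\cong L$ equivariantly. Let $x\in D$, and let $n_x\in\{1,\dots,p-1\}$ be defined by $df_x=\zeta^{n_x}$. Assume that $\Phi$ is holomorphic near $x$, that the eigenvalues of $f_E(x)$ are $1$ and $\zeta^{b_x}$ with $b_x\in\{1,\dots,p-1\}$, and that $F_x$ is the $\zeta^{b_x}$-eigenspace. Let $L(-x)$ be the equivariant line bundle whose sections are the sections of $L$ vanishing at $x$. Then there are an $\langle f\rangle$-equivariant quasi-parabolic Higgs bundle $(E',F',\Phi')$ on $(X,D)$, with $\det E'\cong L(-x)$ equivariantly, and a morphism $\iota:(E',F',\Phi')\to(E,F,\Phi)$ of $\langle f\rangle$-equivariant quasi-parabolic Higgs bundles such that: 1. $\iota$ restricts to an isomorphism of $\langle f\rangle$-equivariant quasi-parabolic Higgs bundles over $X\setminus\{x\}$. 2. The image of $\iota(x)$ is the $1$-eigenspace of $f_E(x)$. The kernel of $\iota(x)$ is $F'_x$; $f_{E'}(x)$ acts on $F'_x$ as $\zeta^{b_x-n_x}$, and $F'_x$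 is the whole $\zeta^{b_x-n_x}$-eigenspace of $f_{E'}(x)$ if $b_x\neq n_x$. The other eigenvalue of $f_{E'}(x)$, i.e. its eigenvalue on $E'_x/F'_x$, is $1$. 3. $\Phi'$ has at most a simple pole at $x$, with residue nilpotent with respect to $E'_x\supset F'_x\supset 0$ (it maps $E'_x$ into $F'_x$ and $F'_x$ to $0$), and if $\mathrm{Res}_x(\Phi')\neq 0$ then $b_x=n_x$. 4. With $T_x$ the skyscraper sheaf at $x$ with fibre $E_x/\ker(f_E(x)-\mathrm{Id})$ and $\lambda$ the evaluation at $x$, the sequence $0\to\mathcal O_{E'}\xrightarrow{\ \iota\ }\mathcal O_E\xrightarrow{\ \lambda\ }T_x\to0$ of $\langle f\rangle$-equivariant sheaves is exact. -/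

import Mathlib

open Bundle Set Filter Topology
open scoped Manifold ContDiff

noncomputable section

namespace HeckeHiggs

universe u

/-! ### Holomorphic vector bundles -/

/-- A holomorphic vector bundle of rank `r` over `X` (bundled form of Mathlib's notion). -/
structure HolBundle (X : Type u) [TopologicalSpace X] [ChartedSpace ℂ X] (r : ℕ) where
  fiber : X → Type
  [addCommGroup : ∀ y, AddCommGroup (fiber y)]
  [module : ∀ y, Module ℂ (fiber y)]
  [topFiber : ∀ y, TopologicalSpace (fiber y)]
  [topTotal : TopologicalSpace (TotalSpace (Fin r → ℂ) fiber)]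
  [fiberBundle : FiberBundle (Fin r → ℂ) fiber]
  [vectorBundle : VectorBundle ℂ (Fin r → ℂ) fiber]
  [holomorphic : ContMDiffVectorBundle ω (Fin r → ℂ) fiber 𝓘(ℂ, ℂ)]

attribute [instance] HolBundle.addCommGroup HolBundle.module HolBundle.topFiber
  HolBundle.topTotal HolBundle.fiberBundle HolBundle.vectorBundle HolBundle.holomorphic

variable {X : Type u} [TopologicalSpace X] [ChartedSpace ℂ X]

/-- The total space of a holomorphic vector bundle. -/
abbrev HolBundle.Total {r : ℕ} (E : HolBundle X r) : Type u := TotalSpace (Fin r → ℂ) E.fiber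

/-- The section `s` of `E` is holomorphic in a neighbourhood of `y`. -/
def HolBundle.HolAt {r : ℕ} (E : HolBundle X r) (s : ∀ y, E.fiber y) (y : X) : Prop :=
  ContMDiffAt 𝓘(ℂ, ℂ) (𝓘(ℂ, ℂ).prod 𝓘(ℂ, Fin r → ℂ)) ω
    (fun z => (⟨z, s z⟩ : E.Total)) y

/-- A family of linear maps `E_y → E'_y` is a map of total spaces over the identity. -/
def totalMap {r r' : ℕ} (E : HolBundle X r) (E' : HolBundle X r')
    (φ : ∀ y, E.fiber y →ₗ[ℂ] E'.fiber y) (v : E.Total) : E'.Total :=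
  ⟨v.1, φ v.1 v.2⟩

/-- A family of linear maps `E_y → E_{f y}` as a map of total spaces covering `f`. -/
def HolBundle.totalLift {r : ℕ} (E : HolBundle X r) (f : X → X)
    (φ : ∀ y, E.fiber y →ₗ[ℂ] E.fiber (f y)) (v : E.Total) : E.Total :=
  ⟨f v.1, φ v.1 v.2⟩

/-! ### Determinants -/

lemma contDiff_det (r : ℕ) :
    ContDiff ℂ ω (fun A : Fin r → Fin r → ℂ => (Matrix.of A).det) := by
  simp only [Matrix.det_apply]
  refine ContDiff.sum fun σ _ => ?_
  refine ContDiff.const_smul _ (contDiff_prod fun i _ => ?_)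
  change ContDiff ℂ ω fun A : Fin r → Fin r → ℂ => A (σ i) i
  fun_prop

lemma contMDiffAt_det {E₀ H₀ M : Type*} [NormedAddCommGroup E₀] [NormedSpace ℂ E₀]
    [TopologicalSpace H₀] {I : ModelWithCorners ℂ E₀ H₀} [TopologicalSpace M] [ChartedSpace H₀ M]
    {r : ℕ} {φ : M → (Fin r → ℂ) →ₗ[ℂ] (Fin r → ℂ)} {y : M}
    (h : ∀ j, ContMDiffAt I 𝓘(ℂ, Fin r → ℂ) ω (fun z => φ z (Pi.single j 1)) y) :
    ContMDiffAt I 𝓘(ℂ, ℂ) ω (fun z => LinearMap.det (φ z)) y := by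
  have h1 : (fun z => LinearMap.det (φ z)) =
      (fun A : Fin r → Fin r → ℂ => (Matrix.of A).det) ∘
        (fun z j => φ z (Pi.single j 1)) := by
    funext z
    simp only [Function.comp]
    rw [← LinearMap.det_toMatrix', ← Matrix.det_transpose]
    rfl
  rw [h1]
  exact (contDiff_det r).contMDiff.contMDiffAt.comp y (contMDiffAt_pi_space.2 h)

/-- The fibre of `E` over `y` in coordinates, using a local trivialization over `y`. -/
def HolBundle.coordOf {r : ℕ} (E : HolBundle X r)
    (e : Trivialization (Fin r → ℂ) (π (Fin r → ℂ) E.fiber)) [MemTrivializationAtlas e]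
    (y : X) (hy : y ∈ e.baseSet) : E.fiber y ≃ₗ[ℂ] (Fin r → ℂ) :=
  e.linearEquivAt ℂ y hy

/-- Coordinates on the fibre `E_y` in the preferred local trivialization at `y`. -/
def HolBundle.coord {r : ℕ} (E : HolBundle X r) (y : X) : E.fiber y ≃ₗ[ℂ] (Fin r → ℂ) :=
  E.coordOf (trivializationAt (Fin r → ℂ) E.fiber y) y
    (mem_baseSet_trivializationAt (Fin r → ℂ) E.fiber y)

/-- The function `det (g_ij)`, where `g_ij` are the transition functions of `E`. -/
def HolBundle.detChange {r : ℕ} (E : HolBundle X r)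
    (i j : trivializationAtlas (Fin r → ℂ) E.fiber) (y : X) : ℂ :=
  haveI : MemTrivializationAtlas i.1 := ⟨i.2⟩
  haveI : MemTrivializationAtlas j.1 := ⟨j.2⟩
  LinearMap.det (i.1.coordChangeL ℂ j.1 y : (Fin r → ℂ) →ₗ[ℂ] (Fin r → ℂ))

lemma HolBundle.detChange_eq {r : ℕ} (E : HolBundle X r)
    (i j : trivializationAtlas (Fin r → ℂ) E.fiber)
    [MemTrivializationAtlas i.1] [MemTrivializationAtlas j.1] (y : X)
    (hi : y ∈ i.1.baseSet) (hj : y ∈ j.1.baseSet) :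
    E.detChange i j y =
      LinearMap.det (((E.coordOf i.1 y hi).symm.trans (E.coordOf j.1 y hj) :
        (Fin r → ℂ) ≃ₗ[ℂ] (Fin r → ℂ)) : (Fin r → ℂ) →ₗ[ℂ] (Fin r → ℂ)) := by
  unfold HolBundle.detChange
  have := Trivialization.coe_coordChangeL' (R := ℂ) i.1 j.1 ⟨hi, hj⟩
  exact congrArg (fun e : (Fin r → ℂ) ≃ₗ[ℂ] (Fin r → ℂ) => LinearMap.det e.toLinearMap) this

lemma HolBundle.detChange_contMDiffOn {r : ℕ} (E : HolBundle X r)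
    (i j : trivializationAtlas (Fin r → ℂ) E.fiber) :
    ContMDiffOn 𝓘(ℂ, ℂ) 𝓘(ℂ, ℂ) ω (E.detChange i j) (i.1.baseSet ∩ j.1.baseSet) := by
  have : MemTrivializationAtlas i.1 := ⟨i.2⟩
  have : MemTrivializationAtlas j.1 := ⟨j.2⟩
  intro y hy
  refine (contMDiffAt_det fun k => ?_).contMDiffWithinAt
  exact (contMDiffAt_coordChangeL (IB := 𝓘(ℂ, ℂ)) (n := ω) hy.1 hy.2).clm_apply
    contMDiffAt_const

lemma contMDiff_toSmul {s : Set X} {g : X → ℂ} (hg : ContMDiffOn 𝓘(ℂ, ℂ) 𝓘(ℂ, ℂ) ω g s) :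
    ContMDiffOn 𝓘(ℂ, ℂ) 𝓘(ℂ, (Fin 1 → ℂ) →L[ℂ] (Fin 1 → ℂ)) ω
      (fun y => g y • ContinuousLinearMap.id ℂ (Fin 1 → ℂ)) s :=
  hg.smul contMDiffOn_const

/-- The cocycle `det (g_ij)`, where `g_ij` are the transition functions of `E`. -/
def HolBundle.detCore {r : ℕ} (E : HolBundle X r) :
    VectorBundleCore ℂ X (Fin 1 → ℂ) (trivializationAtlas (Fin r → ℂ) E.fiber) where
  baseSet e := e.1.baseSet
  isOpen_baseSet e := e.1.open_baseSet
  indexAt y := ⟨trivializationAt (Fin r → ℂ) E.fiber y,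
    FiberBundle.trivialization_mem_atlas' y⟩
  mem_baseSet_at y := mem_baseSet_trivializationAt (Fin r → ℂ) E.fiber y
  coordChange i j y := E.detChange i j y • ContinuousLinearMap.id ℂ (Fin 1 → ℂ)
  coordChange_self i y hy v := by
    have : MemTrivializationAtlas i.1 := ⟨i.2⟩
    rw [E.detChange_eq i i y hy hy]
    simp
  continuousOn_coordChange i j := (contMDiff_toSmul (E.detChange_contMDiffOn i j)).continuousOn
  coordChange_comp i j k y hy v := by
    have : MemTrivializationAtlas i.1 := ⟨i.2⟩
    have : MemTrivializationAtlas j.1 := ⟨j.2⟩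
    have : MemTrivializationAtlas k.1 := ⟨k.2⟩
    rw [E.detChange_eq i j y hy.1.1 hy.1.2, E.detChange_eq j k y hy.1.2 hy.2,
      E.detChange_eq i k y hy.1.1 hy.2]
    simp only [smul_apply, ContinuousLinearMap.id_apply, smul_smul]
    rw [← LinearMap.det_comp]
    congr 2
    ext v
    simp

instance {r : ℕ} (E : HolBundle X r) : E.detCore.IsContMDiff 𝓘(ℂ, ℂ) ω where
  contMDiffOn_coordChange i j := contMDiff_toSmul (E.detChange_contMDiffOn i j)

/-- The determinant line bundle of `E`. -/
def HolBundle.det {r : ℕ} (E : HolBundle X r) : HolBundle X 1 where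
  fiber := E.detCore.Fiber

/-- The map `det E_y → det E_{y'}` induced by a linear map `E_y → E_{y'}`. -/
def HolBundle.detMap {r : ℕ} (E : HolBundle X r) {y y' : X}
    (φ : E.fiber y →ₗ[ℂ] E.fiber y') : E.det.fiber y →ₗ[ℂ] E.det.fiber y' :=
  (LinearMap.det ((E.coord y').toLinearMap ∘ₗ φ ∘ₗ (E.coord y).symm.toLinearMap) •
    LinearMap.id : (Fin 1 → ℂ) →ₗ[ℂ] (Fin 1 → ℂ))

/-! ### Equivariant bundles -/

/-- Holomorphic automorphisms of `X`. -/
abbrev HolAut (X : Type u) [TopologicalSpace X] [ChartedSpace ℂ X] : Type u :=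
  Diffeomorph 𝓘(ℂ, ℂ) 𝓘(ℂ, ℂ) X X ω

/-- An `⟨f⟩`-equivariant holomorphic vector bundle of rank `r`: a holomorphic vector bundle with
a lift of the action of the cyclic group `⟨f⟩`, given by the generator `lift`, which covers `f`,
is holomorphic and linear on the fibres, and satisfies the relation of the generator `f`. -/
structure EquivBundle (f : HolAut X) (r : ℕ) extends HolBundle X r where
  lift : ∀ y, fiber y →ₗ[ℂ] fiber (f y)
  lift_holomorphic :
    ContMDiff (𝓘(ℂ, ℂ).prod 𝓘(ℂ, Fin r → ℂ)) (𝓘(ℂ, ℂ).prod 𝓘(ℂ, Fin r → ℂ)) ω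
      (toHolBundle.totalLift f lift)
  lift_order : (toHolBundle.totalLift f lift)^[orderOf f.toEquiv] = id

lemma HolBundle.detMap_comp {r : ℕ} (E : HolBundle X r) {y₁ y₂ y₃ : X}
    (ψ : E.fiber y₂ →ₗ[ℂ] E.fiber y₃) (φ : E.fiber y₁ →ₗ[ℂ] E.fiber y₂) (v : E.det.fiber y₁) :
    E.detMap (ψ ∘ₗ φ) v = E.detMap ψ (E.detMap φ v) := by
  have h : (E.coord y₃).toLinearMap ∘ₗ (ψ ∘ₗ φ) ∘ₗ (E.coord y₁).symm.toLinearMap =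
      ((E.coord y₃).toLinearMap ∘ₗ ψ ∘ₗ (E.coord y₂).symm.toLinearMap) ∘ₗ
      ((E.coord y₂).toLinearMap ∘ₗ φ ∘ₗ (E.coord y₁).symm.toLinearMap) := by
    ext v
    simp
  unfold HolBundle.detMap
  rw [h, LinearMap.det_comp, mul_smul]
  rfl

lemma HolBundle.detMap_id {r : ℕ} (E : HolBundle X r) {y : X} (v : E.det.fiber y) :
    E.detMap (LinearMap.id : E.fiber y →ₗ[ℂ] E.fiber y) v = v := by
  have h : (E.coord y).toLinearMap ∘ₗ LinearMap.id ∘ₗ (E.coord y).symm.toLinearMap =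
      LinearMap.id := by
    ext v
    simp
  unfold HolBundle.detMap
  rw [h, LinearMap.det_id, one_smul]
  rfl

lemma HolBundle.detMap_iter {r : ℕ} (E : HolBundle X r) (f : X → X)
    (φ : ∀ y, E.fiber y →ₗ[ℂ] E.fiber (f y)) (k : ℕ) (y : X) :
    ∃ (ψ : E.fiber y →ₗ[ℂ] E.fiber (f^[k] y)),
      (∀ v, (E.totalLift f φ)^[k] ⟨y, v⟩ = ⟨f^[k] y, ψ v⟩) ∧
      (∀ v, (E.det.totalLift f fun y => E.detMap (φ y))^[k] ⟨y, v⟩ =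
        ⟨f^[k] y, E.detMap ψ v⟩) := by
  induction k generalizing y with
  | zero =>
    exact ⟨LinearMap.id, fun v => rfl,
      fun v => congrArg (TotalSpace.mk y) (E.detMap_id v).symm⟩
  | succ k ih =>
    obtain ⟨ψ, h1, h2⟩ := ih (f y)
    exact ⟨ψ ∘ₗ φ y, fun v => h1 (φ y v), fun v => (h2 (E.detMap (φ y) v)).trans
      (congrArg (TotalSpace.mk (f^[k] (f y))) (E.detMap_comp ψ (φ y) v).symm)⟩

lemma HolBundle.detMap_order {r : ℕ} (E : HolBundle X r) (f : X → X)
    (φ : ∀ y, E.fiber y →ₗ[ℂ] E.fiber (f y)) (k : ℕ) (h : (E.totalLift f φ)^[k] = id) :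
    (E.det.totalLift f fun y => E.detMap (φ y))^[k] = id := by
  funext ⟨y, v⟩
  obtain ⟨ψ, h1, h2⟩ := E.detMap_iter f φ k y
  rw [h2]
  rw [h] at h1
  have aux : ∀ (y' : X) (ψ : E.fiber y →ₗ[ℂ] E.fiber y'),
      (∀ v, (⟨y, v⟩ : E.Total) = ⟨y', ψ v⟩) →
      (⟨y', E.detMap ψ v⟩ : E.det.Total) = ⟨y, v⟩ := by
    intro y' ψ hψ
    obtain rfl : y = y' := congrArg TotalSpace.proj (hψ 0)
    have : ψ = LinearMap.id := by
      ext w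
      have := hψ w
      simpa using this.symm
    rw [this, E.detMap_id]
  exact aux _ ψ h1

lemma HolBundle.det_triv_apply {r : ℕ} (E : HolBundle X r) (y₀ : X) (v : E.det.Total) :
    (trivializationAt (Fin 1 → ℂ) E.det.fiber y₀ v).2 =
      (E.detChange (E.detCore.indexAt v.1) (E.detCore.indexAt y₀) v.1 •
        (v.2 : Fin 1 → ℂ) : Fin 1 → ℂ) := rfl

/-- A linear map between fibres, written in given local trivializations. -/
def HolBundle.inTriv {r : ℕ} (E : HolBundle X r)
    (e e' : Trivialization (Fin r → ℂ) (π (Fin r → ℂ) E.fiber))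
    [MemTrivializationAtlas e] [MemTrivializationAtlas e'] {y y' : X}
    (φ : E.fiber y →ₗ[ℂ] E.fiber y') : (Fin r → ℂ) →ₗ[ℂ] (Fin r → ℂ) :=
  e'.linearMapAt ℂ y' ∘ₗ φ ∘ₗ e.symmₗ ℂ y

lemma HolBundle.det_inTriv {r : ℕ} (E : HolBundle X r) (y₀ y₁ : X) {y y' : X}
    (φ : E.fiber y →ₗ[ℂ] E.fiber y')
    (hy : y ∈ (trivializationAt (Fin r → ℂ) E.fiber y₀).baseSet)
    (hy' : y' ∈ (trivializationAt (Fin r → ℂ) E.fiber y₁).baseSet) (v : E.det.fiber y) :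
    (trivializationAt (Fin 1 → ℂ) E.det.fiber y₁ ⟨y', E.detMap φ v⟩).2 =
      LinearMap.det (E.inTriv (trivializationAt (Fin r → ℂ) E.fiber y₀)
        (trivializationAt (Fin r → ℂ) E.fiber y₁) φ) •
      (trivializationAt (Fin 1 → ℂ) E.det.fiber y₀ ⟨y, v⟩).2 := by
  rw [E.det_triv_apply, E.det_triv_apply]
  have hi : ∀ z, MemTrivializationAtlas (E.detCore.indexAt z).1 :=
    fun z => ⟨(E.detCore.indexAt z).2⟩
  have := hi y
  have := hi y'
  have := hi y₀
  have := hi y₁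
  rw [E.detChange_eq (E.detCore.indexAt y) (E.detCore.indexAt y₀) y
      (E.detCore.mem_baseSet_at y) hy,
    E.detChange_eq (E.detCore.indexAt y') (E.detCore.indexAt y₁) y'
      (E.detCore.mem_baseSet_at y') hy']
  have hs : ∀ (a b c d : ℂ) (u : Fin 1 → ℂ), a * b = c * d → a • b • u = c • d • u := by
    intro a b c d u h
    rw [smul_smul, smul_smul, h]
  refine hs _ (LinearMap.det ((E.coord y').toLinearMap ∘ₗ φ ∘ₗ (E.coord y).symm.toLinearMap))
    _ _ v ?_
  rw [← LinearMap.det_comp, ← LinearMap.det_comp]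
  congr 1
  refine LinearMap.ext fun w => ?_
  have h3 : (E.coordOf (E.detCore.indexAt y').1 y' (E.detCore.mem_baseSet_at y')).symm
      (E.coord y' (φ ((E.coord y).symm w))) = φ ((E.coord y).symm w) :=
    LinearEquiv.symm_apply_apply (E.coord y') _
  have h4 : (trivializationAt (Fin r → ℂ) E.fiber y₀).symmₗ ℂ y
      (E.coordOf (E.detCore.indexAt y₀).1 y hy ((E.coord y).symm w)) = (E.coord y).symm w := by
    rw [Trivialization.symmₗ_apply _ hy]
    exact Trivialization.symm_apply_apply_mk _ hy _
  have h5 : ∀ u, (trivializationAt (Fin r → ℂ) E.fiber y₁).linearMapAt ℂ y' u =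
      E.coordOf (E.detCore.indexAt y₁).1 y' hy' u := fun u => by
    rw [Trivialization.linearMapAt_apply, if_pos hy']
    rfl
  simp only [LinearMap.comp_apply, LinearEquiv.coe_coe, LinearEquiv.trans_apply,
    HolBundle.inTriv]
  rw [h3, h5]
  exact congrArg _ (congrArg _ h4.symm)

lemma HolBundle.detMap_holomorphic {r : ℕ} (E : HolBundle X r) (f : HolAut X)
    (φ : ∀ y, E.fiber y →ₗ[ℂ] E.fiber (f y))
    (hφ : ContMDiff (𝓘(ℂ, ℂ).prod 𝓘(ℂ, Fin r → ℂ)) (𝓘(ℂ, ℂ).prod 𝓘(ℂ, Fin r → ℂ)) ω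
      (E.totalLift f φ)) :
    ContMDiff (𝓘(ℂ, ℂ).prod 𝓘(ℂ, Fin 1 → ℂ)) (𝓘(ℂ, ℂ).prod 𝓘(ℂ, Fin 1 → ℂ)) ω
      (E.det.totalLift f fun y => E.detMap (φ y)) := by
  intro v₀
  set e := trivializationAt (Fin r → ℂ) E.fiber v₀.1 with he
  set e' := trivializationAt (Fin r → ℂ) E.fiber (f v₀.1) with he'
  have hb : ContMDiffAt (𝓘(ℂ, ℂ).prod 𝓘(ℂ, Fin 1 → ℂ)) 𝓘(ℂ, ℂ) ω
      (fun v : E.det.Total => v.1) v₀ := contMDiffAt_proj _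
  have hfb : ContMDiffAt (𝓘(ℂ, ℂ).prod 𝓘(ℂ, Fin 1 → ℂ)) 𝓘(ℂ, ℂ) ω
      (fun v : E.det.Total => f v.1) v₀ := f.contMDiff.contMDiffAt.comp v₀ hb
  have hm : ∀ᶠ v : E.det.Total in 𝓝 v₀, v.1 ∈ e.baseSet :=
    hb.continuousAt.eventually (e.open_baseSet.mem_nhds
      (mem_baseSet_trivializationAt (Fin r → ℂ) E.fiber v₀.1))
  have hm' : ∀ᶠ v : E.det.Total in 𝓝 v₀, f v.1 ∈ e'.baseSet :=
    hfb.continuousAt.eventually (e'.open_baseSet.mem_nhds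
      (mem_baseSet_trivializationAt (Fin r → ℂ) E.fiber (f v₀.1)))
  rw [contMDiffAt_totalSpace]
  refine ⟨hfb, ?_⟩
  have key : ContMDiffAt (𝓘(ℂ, ℂ).prod 𝓘(ℂ, Fin 1 → ℂ)) 𝓘(ℂ, ℂ) ω
      (fun v : E.det.Total => LinearMap.det (E.inTriv e e' (φ v.1))) v₀ := by
    refine contMDiffAt_det fun j => ?_
    have hs : ContMDiffAt 𝓘(ℂ, ℂ) (𝓘(ℂ, ℂ).prod 𝓘(ℂ, Fin r → ℂ)) ω
        (fun z => (⟨z, e.symm z (Pi.single j 1)⟩ : E.Total)) v₀.1 := by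
      rw [e.contMDiffAt_section_iff (mem_baseSet_trivializationAt (Fin r → ℂ) E.fiber v₀.1)]
      refine (contMDiffAt_const (c := (Pi.single j 1 : Fin r → ℂ))).congr_of_eventuallyEq ?_
      filter_upwards [e.open_baseSet.mem_nhds
        (mem_baseSet_trivializationAt (Fin r → ℂ) E.fiber v₀.1)] with z hz
      rw [e.apply_mk_symm hz]
    have hs2 := (contMDiffAt_totalSpace.1 ((hφ.contMDiffAt).comp v₀.1 hs)).2
    refine (hs2.comp v₀ hb).congr_of_eventuallyEq ?_
    filter_upwards [hm, hm'] with v h1 h2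
    simp only [HolBundle.inTriv, LinearMap.comp_apply, Function.comp, HolBundle.totalLift]
    rw [e.symmₗ_apply h1, e'.linearMapAt_apply, if_pos h2]
  have hv : ContMDiffAt (𝓘(ℂ, ℂ).prod 𝓘(ℂ, Fin 1 → ℂ)) 𝓘(ℂ, Fin 1 → ℂ) ω
      (fun v : E.det.Total => (trivializationAt (Fin 1 → ℂ) E.det.fiber v₀.1 v).2) v₀ :=
    (contMDiffAt_totalSpace.1 (contMDiffAt_id (x := v₀))).2
  refine (key.smul hv).congr_of_eventuallyEq ?_
  filter_upwards [hm, hm'] with v h1 h2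
  exact E.det_inTriv v₀.1 (f v₀.1) (φ v.1) h1 h2 v.2

/-- The determinant of an equivariant bundle, with the induced equivariant structure. -/
def EquivBundle.det {f : HolAut X} {r : ℕ} (E : EquivBundle f r) : EquivBundle f 1 where
  toHolBundle := E.toHolBundle.det
  lift y := E.detMap (E.lift y)
  lift_holomorphic := E.detMap_holomorphic f E.lift E.lift_holomorphic
  lift_order := E.detMap_order f E.lift _ E.lift_order

/-- At a fixed point `x` of `f`, the endomorphism `f_E(x)` of the fibre `E_x` given by the
generator of the action. -/
def EquivBundle.atFixed {f : HolAut X} {r : ℕ} (E : EquivBundle f r) {x : X} (hx : f x = x) :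
    Module.End ℂ (E.fiber x) :=
  (LinearEquiv.cast (R := ℂ) (M := E.fiber) hx).toLinearMap ∘ₗ E.lift x

/-- A morphism of `⟨f⟩`-equivariant holomorphic vector bundles (over the identity of `X`). -/
structure EquivHom {f : HolAut X} {r r' : ℕ} (E : EquivBundle f r) (E' : EquivBundle f r') where
  map : ∀ y, E.fiber y →ₗ[ℂ] E'.fiber y
  holomorphic :
    ContMDiff (𝓘(ℂ, ℂ).prod 𝓘(ℂ, Fin r → ℂ)) (𝓘(ℂ, ℂ).prod 𝓘(ℂ, Fin r' → ℂ)) ω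
      (totalMap E.toHolBundle E'.toHolBundle map)
  equivariant : ∀ y v, map (f y) (E.lift y v) = E'.lift y (map y v)

/-- Two equivariant bundles are equivariantly isomorphic. -/
def EquivIso {f : HolAut X} {r : ℕ} (E E' : EquivBundle f r) : Prop :=
  ∃ (φ : EquivHom E E') (ψ : EquivHom E' E),
    (∀ y v, ψ.map y (φ.map y v) = v) ∧ (∀ y v, φ.map y (ψ.map y v) = v)

/-- The morphism `φ : E' → E` induces, over every open set `U`, a bijection from the holomorphic
sections of `E'` onto the holomorphic sections `s` of `E` which satisfy `s(x) ∈ W` if `x ∈ U`.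
In other words `0 → O(E') → O(E) → E_x / W` is an exact sequence of sheaves, where the last term
is a skyscraper sheaf at `x` and the last map is evaluation at `x`. -/
structure IsSectionKernel {f : HolAut X} {r : ℕ} {E' E : EquivBundle f r} (φ : EquivHom E' E)
    (x : X) (W : Submodule ℂ (E.fiber x)) : Prop where
  injective : ∀ U : Set X, IsOpen U → ∀ s t : ∀ y, E'.fiber y,
    (∀ y ∈ U, E'.HolAt s y) → (∀ y ∈ U, E'.HolAt t y) →
    (∀ y ∈ U, φ.map y (s y) = φ.map y (t y)) → ∀ y ∈ U, s y = t y
  exact : ∀ U : Set X, IsOpen U → ∀ s : ∀ y, E.fiber y, (∀ y ∈ U, E.HolAt s y) →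
    ((∃ t : ∀ y, E'.fiber y, (∀ y ∈ U, E'.HolAt t y) ∧ ∀ y ∈ U, φ.map y (t y) = s y) ↔
      (x ∈ U → W.mkQ (s x) = 0))

/-- The evaluation map from `O(E)` to the skyscraper sheaf at `x` with fibre `E_x / W` is
surjective (as a map of sheaves). -/
def EvalSurjective {f : HolAut X} {r : ℕ} (E : EquivBundle f r)
    (x : X) (W : Submodule ℂ (E.fiber x)) : Prop :=
  ∀ w : E.fiber x ⧸ W, ∃ U : Set X, IsOpen U ∧ x ∈ U ∧ ∃ s : ∀ y, E.fiber y,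
    (∀ y ∈ U, E.HolAt s y) ∧ W.mkQ (s x) = w

/-- `L'` is the equivariant line bundle `L(-x)`: its sheaf of sections is, equivariantly, the
subsheaf of the sheaf of sections of `L` consisting of the sections which vanish at `x`. -/
def IsTwistDown {f : HolAut X} (L' L : EquivBundle f 1) (x : X) : Prop :=
  ∃ j : EquivHom L' L, IsSectionKernel j x ⊥

/-! ### Quasi-parabolic Higgs bundles -/

/-- A (not necessarily holomorphic) field of maps `T_y X → End E_y`, i.e. a section of
`End(E) ⊗ K`. -/
abbrev HolBundle.HiggsField {r : ℕ} (E : HolBundle X r) : Type u :=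
  ∀ y : X, TangentSpace 𝓘(ℂ, ℂ) y →ₗ[ℂ] Module.End ℂ (E.fiber y)

/-- The centred local coordinate `z` at `x`, given by the preferred chart at `x`. -/
def coordAt (x y : X) : ℂ := chartAt ℂ x y - chartAt ℂ x x

/-- The coordinate vector field `∂/∂z` of the preferred chart at `x` (on the chart domain). -/
def coordVec [IsManifold 𝓘(ℂ, ℂ) ω X] (x y : X) : TangentSpace 𝓘(ℂ, ℂ) y :=
  (trivializationAt ℂ (TangentSpace 𝓘(ℂ, ℂ) : X → Type) x).symm y (1 : ℂ)

variable [IsManifold 𝓘(ℂ, ℂ) ω X]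

/-- `Φ` is holomorphic in a neighbourhood of `x`. -/
def HolBundle.HiggsHolAt {r : ℕ} (E : HolBundle X r) (Φ : E.HiggsField) (x : X) : Prop :=
  ∀ s : ∀ y, E.fiber y, E.HolAt s x → E.HolAt (fun y => Φ y (coordVec x y) (s y)) x

open Classical in
/-- `Φ`, regarded as a section of `End(E) ⊗ K` on a punctured neighbourhood of `x`, extends to a
holomorphic section on a neighbourhood of `x`, with value `A` at `x`. -/
def HolBundle.HiggsExtends {r : ℕ} (E : HolBundle X r) (Φ : E.HiggsField) (x : X)
    (A : TangentSpace 𝓘(ℂ, ℂ) x →ₗ[ℂ] Module.End ℂ (E.fiber x)) : Prop :=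
  E.HiggsHolAt (Function.update Φ x A) x

open Classical in
/-- `Φ`, regarded as a section of `End(E) ⊗ K` on a punctured neighbourhood of `x`, has at most a
simple pole at `x`, with residue `R`: the section `z · Φ(∂/∂z)` of `End(E)` extends to a
holomorphic section near `x`, with value `R` at `x`. -/
def HolBundle.HasResidue {r : ℕ} (E : HolBundle X r) (Φ : E.HiggsField) (x : X)
    (R : Module.End ℂ (E.fiber x)) : Prop :=
  ∀ s : ∀ y, E.fiber y, E.HolAt s x →
    E.HolAt (Function.update (fun y => coordAt x y • Φ y (coordVec x y) (s y)) x (R (s x))) x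

/-- `(E, F, Φ)` is a quasi-parabolic Higgs bundle of rank two on `(X, D)`, with full flags
`E_y ⊃ F_y ⊃ 0` at the marked points `y ∈ D` and trace-free Higgs field `Φ` on `X \ D`, which has
at most simple poles at the points of `D`, with residues nilpotent with respect to the flags.
The values of `F` off `D`, and of `Φ` on `D`, are irrelevant. -/
structure IsQuasiParabolicHiggs (E : HolBundle X 2) (D : Finset X)
    (F : ∀ y, Submodule ℂ (E.fiber y)) (Φ : E.HiggsField) : Prop where
  flag : ∀ y ∈ D, Module.finrank ℂ (F y) = 1
  traceFree : ∀ y, y ∉ D → ∀ v, LinearMap.trace ℂ (E.fiber y) (Φ y v) = 0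
  holomorphic : ∀ y, y ∉ D → E.HiggsHolAt Φ y
  nilpotentResidue : ∀ y ∈ D, ∃ R : Module.End ℂ (E.fiber y), E.HasResidue Φ y R ∧
    (∀ v, R v ∈ F y) ∧ (∀ v ∈ F y, R v = 0)

/-- An `⟨f⟩`-equivariant quasi-parabolic Higgs bundle of rank two on `(X, D)`, where `D` consists
of fixed points of `f`: the generator `lift` of the action on `E` is an isomorphism
`(E, F, Φ) → f^*(E, F, Φ)`. -/
structure EquivHiggs (f : HolAut X) (D : Finset X) extends EquivBundle f 2 where
  F : ∀ y, Submodule ℂ (fiber y)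
  Φ : toHolBundle.HiggsField
  isHiggs : IsQuasiParabolicHiggs toHolBundle D F Φ
  marked_fixed : ∀ y ∈ D, f y = y
  flag_equivariant : ∀ y ∈ D, (F y).map (lift y) = F (f y)
  higgs_equivariant : ∀ y, y ∉ D → ∀ (v : TangentSpace 𝓘(ℂ, ℂ) y) (w : fiber y),
    lift y (Φ y v w) = Φ (f y) (mfderiv 𝓘(ℂ, ℂ) 𝓘(ℂ, ℂ) f y v) (lift y w)

/-- A morphism of `⟨f⟩`-equivariant quasi-parabolic Higgs bundles. -/
structure HiggsHom {f : HolAut X} {D : Finset X} (E E' : EquivHiggs f D) extends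
    EquivHom E.toEquivBundle E'.toEquivBundle where
  map_flag : ∀ y ∈ D, (E.F y).map (map y) ≤ E'.F y
  map_higgs : ∀ y, y ∉ D → ∀ v w, map y (E.Φ y v w) = E'.Φ y v (map y w)

/-- The morphism `φ` restricts to an isomorphism of equivariant quasi-parabolic Higgs bundles over
the (`f`-invariant, open) set `U`: over `U` there is a two-sided inverse which is a morphism of
equivariant quasi-parabolic Higgs bundles. -/
def HiggsHom.IsIsoOn {f : HolAut X} {D : Finset X} {E E' : EquivHiggs f D} (φ : HiggsHom E E')
    (U : Set X) : Prop :=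
  ∃ ψ : ∀ y, E'.fiber y →ₗ[ℂ] E.fiber y,
    (∀ y ∈ U, ∀ v, ψ y (φ.map y v) = v) ∧
    (∀ y ∈ U, ∀ v, φ.map y (ψ y v) = v) ∧
    ContMDiffOn (𝓘(ℂ, ℂ).prod 𝓘(ℂ, Fin 2 → ℂ)) (𝓘(ℂ, ℂ).prod 𝓘(ℂ, Fin 2 → ℂ)) ω
      (totalMap E'.toHolBundle E.toHolBundle ψ) {v | v.1 ∈ U} ∧
    (∀ y ∈ U, f y ∈ U → ∀ v, ψ (f y) (E'.lift y v) = E.lift y (ψ y v)) ∧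
    (∀ y ∈ U, y ∈ D → (E'.F y).map (ψ y) ≤ E.F y) ∧
    (∀ y ∈ U, y ∉ D → ∀ v w, ψ y (E'.Φ y v w) = E.Φ y v (ψ y w))

end HeckeHiggs

end

open HeckeHiggs

noncomputable section

namespace HeckeHiggs

universe u

set_option linter.unusedSectionVars false

variable {X : Type u} [TopologicalSpace X] [ChartedSpace ℂ X]
variable [IsManifold 𝓘(ℂ, ℂ) ω X]

/-! ### Local coordinates on holomorphic bundles -/

/-! `E'` is the Hecke transform of `E` at `x`: its sections are the sections of `E` whose value at
`x` lies in the 1-eigenspace of `f_E(x)`. Let `z` be a centred coordinate at `x` and `(e₀, e₁)` a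
local frame of `E` whose values at `x` are eigenvectors for `1` and `ζ^b`; it need not be an
eigenframe at other points. Then `(e₀, z e₁)` is a frame of `E'` and the inclusion has matrix
`diag(1, z)`. Off `x` the inclusion is an isomorphism and all structure is transported through it,
so everything reduces to this matrix near `x`. `HolBundle.hecke` constructs the bundle from a
cocycle, and `IsModification` records the properties of the inclusion that the rest uses.

Lift: if `A` is the matrix of `f_E`, with `A(x) = diag(1, ζ^b)`, the new matrix is `diag(1, z∘f)⁻¹ A
diag(1, z)`. Since `z∘f = z u` with `u(x) = ζ^n`, and the lower left entry of `A` vanishes at `x`,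
this is holomorphic (`exists_factor`). Its value at `x` is lower triangular with diagonal `1,
ζ^(b-n)`, and `eigenspaces_of_triangular` reads off the eigenvalues. The relation on iterates of the
lift holds off `x`, hence everywhere by density.

Higgs field: conjugating a holomorphic matrix `P` by `diag(1, z)` divides only the lower left entry
by `z`. The residue is therefore strictly lower triangular with entry `P₁₀(x)`. Equivariance of `Φ`
in the limit at `x` gives `ζ^b P₁₀(x) = ζ^n P₁₀(x)` (`EquivHiggs.weight_eq`), so a nonzero residue
forces `b = n`.

Determinant and exactness: the determinant of the inclusion is a nonzero constant times `z`, so `det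
E'` is `L(-x)` (`isTwistDown_det`). Both kernel statements follow from division by `z`
(`exists_div_coordAt`) and `isSectionKernel_of_local`. -/

instance HolBundle.t2Space_total [T2Space X] {r : ℕ} (E : HolBundle X r) : T2Space E.Total := by
  refine t2_iff_ultrafilter.2 fun {v w} l hv hw => ?_
  have hc := FiberBundle.continuous_proj (Fin r → ℂ) E.fiber
  -- Two limits of one ultrafilter have the same base point because `X` is Hausdorff. They then lie
  -- in a common trivialization, which embeds into a Hausdorff product.
  have hp : v.1 = w.1 := tendsto_nhds_unique (f := TotalSpace.proj) (l := (l : Filter E.Total))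
    ((hc.tendsto v).mono_left hv) ((hc.tendsto w).mono_left hw)
  set e := trivializationAt (Fin r → ℂ) E.fiber v.1
  have hev : v ∈ e.source :=
    e.mem_source.2 (mem_baseSet_trivializationAt (Fin r → ℂ) E.fiber v.1)
  have hew : w ∈ e.source := by
    rw [e.mem_source, ← hp]
    exact mem_baseSet_trivializationAt (Fin r → ℂ) E.fiber v.1
  refine e.injOn hev hew ?_
  exact tendsto_nhds_unique (f := e) (l := (l : Filter E.Total))
    ((e.continuousAt hev).tendsto.mono_left hv) ((e.continuousAt hew).tendsto.mono_left hw)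

/-- The families `τ_y : E_y → ℂ^r` and `σ_y : ℂ^r → E_y` are, near `x`, mutually inverse
holomorphic coordinates on `E`. -/
structure IsCoordAt {r : ℕ} (E : HolBundle X r) (x : X) (τ : ∀ y, E.fiber y →ₗ[ℂ] (Fin r → ℂ))
    (σ : ∀ y, (Fin r → ℂ) →ₗ[ℂ] E.fiber y) : Prop where
  left : ∀ᶠ y in 𝓝 x, ∀ v, σ y (τ y v) = v
  right : ∀ᶠ y in 𝓝 x, ∀ w, τ y (σ y w) = w
  -- Tested along maps `g` with `g y₀ = x` and not only on sections, because the lift turns a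
  -- section into a map covering `f`.
  hol_iff : ∀ (g : X → X) (y₀ : X), ContMDiffAt 𝓘(ℂ, ℂ) 𝓘(ℂ, ℂ) ω g y₀ → g y₀ = x →
    ∀ s : ∀ y, E.fiber (g y),
    (ContMDiffAt 𝓘(ℂ, ℂ) (𝓘(ℂ, ℂ).prod 𝓘(ℂ, Fin r → ℂ)) ω (fun y => (⟨g y, s y⟩ : E.Total)) y₀ ↔
      ContMDiffAt 𝓘(ℂ, ℂ) 𝓘(ℂ, Fin r → ℂ) ω (fun y => τ (g y) (s y)) y₀)

/-- Coordinates on the fibres of `E` near `x` in the preferred trivialization at `x`. -/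
def HolBundle.triv {r : ℕ} (E : HolBundle X r) (x y : X) : E.fiber y →ₗ[ℂ] (Fin r → ℂ) :=
  (trivializationAt (Fin r → ℂ) E.fiber x).linearMapAt ℂ y

/-- The inverse of the coordinates in the preferred trivialization at `x`. -/
def HolBundle.trivSymm {r : ℕ} (E : HolBundle X r) (x y : X) : (Fin r → ℂ) →ₗ[ℂ] E.fiber y :=
  (trivializationAt (Fin r → ℂ) E.fiber x).symmₗ ℂ y

/-- The domain of the preferred trivialization at `x`. -/
def HolBundle.base {r : ℕ} (E : HolBundle X r) (x : X) : Set X :=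
  (trivializationAt (Fin r → ℂ) E.fiber x).baseSet

section
variable {r : ℕ} (E : HolBundle X r) (x : X)

lemma HolBundle.isOpen_base : IsOpen (E.base x) :=
  (trivializationAt (Fin r → ℂ) E.fiber x).open_baseSet

lemma HolBundle.mem_base : x ∈ E.base x := mem_baseSet_trivializationAt (Fin r → ℂ) E.fiber x

lemma HolBundle.base_mem_nhds : E.base x ∈ 𝓝 x := (E.isOpen_base x).mem_nhds (E.mem_base x)

variable {x} {y : X}

lemma HolBundle.triv_apply (hy : y ∈ E.base x) (v : E.fiber y) :
    E.triv x y v = (trivializationAt (Fin r → ℂ) E.fiber x ⟨y, v⟩).2 :=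
  congrFun ((trivializationAt (Fin r → ℂ) E.fiber x).coe_linearMapAt_of_mem hy) v

lemma HolBundle.trivSymm_triv (hy : y ∈ E.base x) (v : E.fiber y) :
    E.trivSymm x y (E.triv x y v) = v :=
  (trivializationAt (Fin r → ℂ) E.fiber x).symmₗ_linearMapAt hy v

lemma HolBundle.triv_trivSymm (hy : y ∈ E.base x) (w : Fin r → ℂ) :
    E.triv x y (E.trivSymm x y w) = w :=
  (trivializationAt (Fin r → ℂ) E.fiber x).linearMapAt_symmₗ hy w

/-- The source is an arbitrary manifold so that one criterion serves sections, maps covering `f`,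
and maps defined on a total space. -/
lemma HolBundle.hol_iff_triv {E₀ H₀ M : Type*} [NormedAddCommGroup E₀] [NormedSpace ℂ E₀]
    [TopologicalSpace H₀] {I : ModelWithCorners ℂ E₀ H₀} [TopologicalSpace M] [ChartedSpace H₀ M]
    {g : M → X} {y₀ : M} (hg : ContMDiffAt I 𝓘(ℂ, ℂ) ω g y₀) (hx : g y₀ ∈ E.base x)
    (s : ∀ y, E.fiber (g y)) :
    ContMDiffAt I (𝓘(ℂ, ℂ).prod 𝓘(ℂ, Fin r → ℂ)) ω (fun y => (⟨g y, s y⟩ : E.Total)) y₀ ↔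
      ContMDiffAt I 𝓘(ℂ, Fin r → ℂ) ω (fun y => E.triv x (g y) (s y)) y₀ := by
  rw [(trivializationAt (Fin r → ℂ) E.fiber x).contMDiffAt_iff (IB := 𝓘(ℂ, ℂ))
    (f := fun y => (⟨g y, s y⟩ : E.Total))
    (((trivializationAt (Fin r → ℂ) E.fiber x).mem_source).2 hx)]
  refine (and_iff_right hg).trans (EventuallyEq.contMDiffAt_iff ?_)
  filter_upwards [hg.continuousAt.eventually ((E.isOpen_base x).mem_nhds hx)] with y hy
  exact (E.triv_apply hy _).symm

lemma HolBundle.isCoordAt_triv : IsCoordAt E x (E.triv x) (E.trivSymm x) where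
  left := by
    filter_upwards [E.base_mem_nhds x] with y hy v using E.trivSymm_triv hy v
  right := by
    filter_upwards [E.base_mem_nhds x] with y hy v using E.triv_trivSymm hy v
  hol_iff g y₀ hg hx s := E.hol_iff_triv hg (hx ▸ E.mem_base _) s

end

lemma contMDiffAt_clm_apply {E₀ H₀ M : Type*} [NormedAddCommGroup E₀] [NormedSpace ℂ E₀]
    [TopologicalSpace H₀] {I : ModelWithCorners ℂ E₀ H₀} [TopologicalSpace M] [ChartedSpace H₀ M]
    {r r' : ℕ} (G : (Fin r → ℂ) →ₗ[ℂ] (Fin r' → ℂ)) {s : M → Fin r → ℂ} {y : M}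
    (hs : ContMDiffAt I 𝓘(ℂ, Fin r → ℂ) ω s y) :
    ContMDiffAt I 𝓘(ℂ, Fin r' → ℂ) ω (fun z => G (s z)) y :=
  (G.toContinuousLinearMap.contMDiff).contMDiffAt.comp y hs

section
variable {r : ℕ} {E : HolBundle X r} {x : X} {τ : ∀ y, E.fiber y →ₗ[ℂ] (Fin r → ℂ)}
  {σ : ∀ y, (Fin r → ℂ) →ₗ[ℂ] E.fiber y}

/-- Local coordinates may be composed with a constant linear automorphism of `ℂ^r`. -/
lemma IsCoordAt.comp (h : IsCoordAt E x τ σ) (G : (Fin r → ℂ) ≃ₗ[ℂ] (Fin r → ℂ)) :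
    IsCoordAt E x (fun y => G.symm.toLinearMap ∘ₗ τ y) (fun y => σ y ∘ₗ G.toLinearMap) where
  left := by filter_upwards [h.left] with y hy v; simp [hy]
  right := by filter_upwards [h.right] with y hy v; simp [hy]
  hol_iff g y₀ hg hx s := by
    rw [h.hol_iff g y₀ hg hx s]
    refine ⟨fun hs => contMDiffAt_clm_apply G.symm.toLinearMap hs, fun hs => ?_⟩
    simpa using contMDiffAt_clm_apply G.toLinearMap hs

end

/-! ### Holomorphic maps of bundles -/

lemma HolBundle.holAt_trivSymm {r : ℕ} (E : HolBundle X r) {x y : X} (hy : y ∈ E.base x)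
    {a : X → Fin r → ℂ} (ha : ContMDiffAt 𝓘(ℂ, ℂ) 𝓘(ℂ, Fin r → ℂ) ω a y) :
    E.HolAt (fun z => E.trivSymm x z (a z)) y := by
  refine (E.hol_iff_triv contMDiffAt_id hy _).2 (ha.congr_of_eventuallyEq ?_)
  filter_upwards [(E.isOpen_base x).mem_nhds hy] with z hz using E.triv_trivSymm hz _

/-- A family of linear maps covering `g` which maps holomorphic sections to holomorphic maps is
holomorphic as a map of total spaces. -/
lemma contMDiffAt_total {r r' : ℕ} {E : HolBundle X r} {E' : HolBundle X r'} {g : X → X}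
    (φ : ∀ y, E.fiber y →ₗ[ℂ] E'.fiber (g y)) (v₀ : E.Total)
    (hg : ContMDiffAt 𝓘(ℂ, ℂ) 𝓘(ℂ, ℂ) ω g v₀.1)
    (h : ∀ s : ∀ y, E.fiber y, E.HolAt s v₀.1 →
      ContMDiffAt 𝓘(ℂ, ℂ) (𝓘(ℂ, ℂ).prod 𝓘(ℂ, Fin r' → ℂ)) ω
        (fun y => (⟨g y, φ y (s y)⟩ : E'.Total)) v₀.1) :
    ContMDiffAt (𝓘(ℂ, ℂ).prod 𝓘(ℂ, Fin r → ℂ)) (𝓘(ℂ, ℂ).prod 𝓘(ℂ, Fin r' → ℂ)) ω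
      (fun v : E.Total => (⟨g v.1, φ v.1 v.2⟩ : E'.Total)) v₀ := by
  set y₀ := v₀.1 with hy₀
  have hb : ContMDiffAt (𝓘(ℂ, ℂ).prod 𝓘(ℂ, Fin r → ℂ)) 𝓘(ℂ, ℂ) ω
      (fun v : E.Total => v.1) v₀ := contMDiffAt_proj _
  have hgb : ContMDiffAt (𝓘(ℂ, ℂ).prod 𝓘(ℂ, Fin r → ℂ)) 𝓘(ℂ, ℂ) ω
      (fun v : E.Total => g v.1) v₀ := hg.comp v₀ hb
  rw [E'.hol_iff_triv hgb (E'.mem_base (g y₀))]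
  have hcol : ∀ j, ContMDiffAt 𝓘(ℂ, ℂ) 𝓘(ℂ, Fin r' → ℂ) ω
      (fun y => E'.triv (g y₀) (g y) (φ y (E.trivSymm y₀ y (Pi.single j 1)))) y₀ := fun j =>
    (E'.hol_iff_triv hg (E'.mem_base (g y₀)) _).1
      (h _ (E.holAt_trivSymm (E.mem_base y₀) contMDiffAt_const))
  have hv : ContMDiffAt (𝓘(ℂ, ℂ).prod 𝓘(ℂ, Fin r → ℂ)) 𝓘(ℂ, Fin r → ℂ) ω
      (fun v : E.Total => E.triv y₀ v.1 v.2) v₀ :=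
    (E.hol_iff_triv (g := fun v : E.Total => v.1) hb (E.mem_base y₀) (fun v => v.2)).1
      contMDiffAt_id
  -- By fibrewise linearity, the map is the sum of the fibre coordinates of `v` times the images of
  -- the frame sections, each of which is holomorphic by hypothesis.
  have hsum : ContMDiffAt (𝓘(ℂ, ℂ).prod 𝓘(ℂ, Fin r → ℂ)) 𝓘(ℂ, Fin r' → ℂ) ω
      (fun v : E.Total => ∑ j, E.triv y₀ v.1 v.2 j •
        E'.triv (g y₀) (g v.1) (φ v.1 (E.trivSymm y₀ v.1 (Pi.single j 1)))) v₀ :=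
    contMDiffAt_finsetSum fun j _ => (contMDiffAt_pi_space.1 hv j).smul ((hcol j).comp v₀ hb)
  refine hsum.congr_of_eventuallyEq ?_
  filter_upwards [hb.continuousAt.eventually (E.base_mem_nhds y₀)] with v hv
  conv_lhs => rw [← E.trivSymm_triv hv v.2]
  conv_lhs => rw [pi_eq_sum_univ' (E.triv y₀ v.1 v.2)]
  simp only [map_sum, map_smul]

lemma holAt_map {r r' : ℕ} {E : HolBundle X r} {E' : HolBundle X r'} {g : X → X}
    (φ : ∀ y, E.fiber y →ₗ[ℂ] E'.fiber (g y)) {s : ∀ y, E.fiber y} {y : X}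
    (h : ContMDiffAt (𝓘(ℂ, ℂ).prod 𝓘(ℂ, Fin r → ℂ)) (𝓘(ℂ, ℂ).prod 𝓘(ℂ, Fin r' → ℂ)) ω
      (fun v : E.Total => (⟨g v.1, φ v.1 v.2⟩ : E'.Total)) ⟨y, s y⟩)
    (hs : E.HolAt s y) :
    ContMDiffAt 𝓘(ℂ, ℂ) (𝓘(ℂ, ℂ).prod 𝓘(ℂ, Fin r' → ℂ)) ω
        (fun y => (⟨g y, φ y (s y)⟩ : E'.Total)) y :=
  h.comp y hs

/-- An operator is the image of its columns under a fixed linear map, so holomorphic columns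
suffice. -/
lemma contMDiffAt_matrix {r r' : ℕ} {A : X → (Fin r → ℂ) →L[ℂ] (Fin r' → ℂ)} {y : X}
    (h : ∀ j, ContMDiffAt 𝓘(ℂ, ℂ) 𝓘(ℂ, Fin r' → ℂ) ω (fun z => A z (Pi.single j 1)) y) :
    ContMDiffAt 𝓘(ℂ, ℂ) 𝓘(ℂ, (Fin r → ℂ) →L[ℂ] (Fin r' → ℂ)) ω A y := by
  let T : (Fin r → Fin r' → ℂ) →ₗ[ℂ] ((Fin r → ℂ) →L[ℂ] (Fin r' → ℂ)) :=
    { toFun := fun B => ∑ j, (ContinuousLinearMap.proj j : (Fin r → ℂ) →L[ℂ] ℂ).smulRight (B j)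
      map_add' := fun B C => by ext; simp [Finset.sum_add_distrib]
      map_smul' := fun c B => by ext; simp [Finset.mul_sum, mul_left_comm] }
  have hA : A = fun z => T.toContinuousLinearMap (fun j => A z (Pi.single j 1)) := by
    funext z
    ext1 w
    conv_lhs => rw [pi_eq_sum_univ' w]
    simp [T]
  rw [hA]
  exact (T.toContinuousLinearMap.contMDiff).contMDiffAt.comp y (contMDiffAt_pi_space.2 h)

/-- A holomorphic map of bundles which is injective at a point has a holomorphic inverse near that
point. -/
lemma contMDiffAt_of_map {r : ℕ} {E E' : HolBundle X r} (φ : ∀ y, E.fiber y →ₗ[ℂ] E'.fiber y)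
    {g : X → X} {y₀ : X} (hg : ContMDiffAt 𝓘(ℂ, ℂ) 𝓘(ℂ, ℂ) ω g y₀)
    (h : ∀ s : ∀ y, E.fiber y, E.HolAt s (g y₀) → E'.HolAt (fun y => φ y (s y)) (g y₀))
    (hφ : Function.Injective (φ (g y₀))) {s : ∀ y, E.fiber (g y)}
    (hs : ContMDiffAt 𝓘(ℂ, ℂ) (𝓘(ℂ, ℂ).prod 𝓘(ℂ, Fin r → ℂ)) ω
      (fun y => (⟨g y, φ (g y) (s y)⟩ : E'.Total)) y₀) :
    ContMDiffAt 𝓘(ℂ, ℂ) (𝓘(ℂ, ℂ).prod 𝓘(ℂ, Fin r → ℂ)) ω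
      (fun y => (⟨g y, s y⟩ : E.Total)) y₀ := by
  set x := g y₀ with hx
  let A : X → (Fin r → ℂ) →L[ℂ] (Fin r → ℂ) := fun y =>
    (E'.triv x y ∘ₗ φ y ∘ₗ E.trivSymm x y).toContinuousLinearMap
  have hA : ContMDiffAt 𝓘(ℂ, ℂ) 𝓘(ℂ, (Fin r → ℂ) →L[ℂ] (Fin r → ℂ)) ω A x :=
    contMDiffAt_matrix fun j => (E'.hol_iff_triv contMDiffAt_id (E'.mem_base x) _).1
      (h _ (E.holAt_trivSymm (E.mem_base x) contMDiffAt_const))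
  have hinj : Function.Injective (E'.triv x x ∘ₗ φ x ∘ₗ E.trivSymm x x) := by
    refine (Function.LeftInverse.injective (E'.trivSymm_triv (E'.mem_base x))).comp
      (hφ.comp (Function.LeftInverse.injective (E.triv_trivSymm (E.mem_base x))))
  have hunit : IsUnit (A x) := by
    have h1 : IsUnit (E'.triv x x ∘ₗ φ x ∘ₗ E.trivSymm x x : Module.End ℂ (Fin r → ℂ)) :=
      (LinearMap.isUnit_iff_ker_eq_bot _).2 (LinearMap.ker_eq_bot.2 hinj)
    exact h1.map (Module.End.toContinuousLinearMap (Fin r → ℂ))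
  -- Inversion is analytic at the units of the Banach algebra of endomorphisms, so the matrix of `φ`
  -- has a holomorphic inverse near `x`.
  have hinv : ContMDiffAt 𝓘(ℂ, ℂ) 𝓘(ℂ, (Fin r → ℂ) →L[ℂ] (Fin r → ℂ)) ω
      (fun y => Ring.inverse (A (g y))) y₀ := by
    obtain ⟨a, ha⟩ := hunit
    refine ContMDiffAt.comp y₀ (g := Ring.inverse) (ContDiffAt.contMDiffAt ?_) (hA.comp y₀ hg)
    change ContDiffAt ℂ ω Ring.inverse (A x)
    rw [← ha]
    exact contDiffAt_ringInverse ℂ a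
  have hw := (E'.hol_iff_triv hg (E'.mem_base x) _).1 hs
  refine (E.hol_iff_triv hg (E.mem_base x) _).2
    ((hinv.clm_apply hw).congr_of_eventuallyEq ?_)
  filter_upwards [hg.continuousAt.eventually (E.base_mem_nhds x),
    hg.continuousAt.eventually (hA.continuousAt.eventually (Units.isOpen.mem_nhds hunit))]
    with y hy hu
  have h1 : Ring.inverse (A (g y)) (A (g y) (E.triv x (g y) (s y))) = E.triv x (g y) (s y) :=
    congrArg (fun B : (Fin r → ℂ) →L[ℂ] (Fin r → ℂ) => B (E.triv x (g y) (s y)))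
      (Ring.inverse_mul_cancel _ hu)
  have h2 : A (g y) (E.triv x (g y) (s y)) = E'.triv x (g y) (φ (g y) (s y)) := by
    simp [A, E.trivSymm_triv hy]
  exact h1.symm.trans (congrArg _ h2)

lemma HolBundle.HolAt.congr {r : ℕ} {E : HolBundle X r} {s t : ∀ y, E.fiber y} {y : X}
    (h : E.HolAt s y) (hst : ∀ᶠ z in 𝓝 y, t z = s z) : E.HolAt t y :=
  ContMDiffAt.congr_of_eventuallyEq h (hst.mono fun _ hz => congrArg _ hz)

/-! ### Points, coordinates and division -/

/-- A Riemann surface has no isolated points, since a chart carries punctured neighbourhoods over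
from `ℂ`. Identities between continuous objects known off `x` therefore extend to `x`. -/
instance neBot_punctured (x : X) : (𝓝[≠] x).NeBot := by
  rw [← mem_closure_iff_nhdsWithin_neBot]
  let e := chartAt ℂ x
  have h1 : Tendsto e.symm (𝓝 (e x)) (𝓝 x) := by
    simpa [e] using (e.continuousAt_symm (mem_chart_target ℂ x)).tendsto
  have h2 : Tendsto e.symm (𝓝[≠] (e x)) (𝓝 x) := h1.mono_left nhdsWithin_le_nhds
  refine mem_closure_of_tendsto h2 ?_
  filter_upwards [self_mem_nhdsWithin,
    nhdsWithin_le_nhds (e.open_target.mem_nhds (mem_chart_target ℂ x))] with w hw hw' h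
  exact hw ((e.right_inv hw').symm.trans (congrArg e h))

lemma eq_of_eventually_punctured {Y : Type*} [TopologicalSpace Y] [T2Space Y] {g h : X → Y}
    {x : X} (hg : ContinuousAt g x) (hh : ContinuousAt h x) (H : ∀ᶠ y in 𝓝[≠] x, g y = h y) :
    g x = h x :=
  tendsto_nhds_unique_of_eventuallyEq (hg.tendsto.mono_left nhdsWithin_le_nhds)
    (hh.tendsto.mono_left nhdsWithin_le_nhds) H

lemma HolBundle.HolAt.eq_at [T2Space X] {r : ℕ} {E : HolBundle X r} {s t : ∀ y, E.fiber y}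
    {x : X} (hs : E.HolAt s x) (ht : E.HolAt t x) (H : ∀ᶠ y in 𝓝[≠] x, s y = t y) :
    s x = t x := by
  have := eq_of_eventually_punctured hs.continuousAt ht.continuousAt
    (H.mono fun y hy => congrArg (TotalSpace.mk y) hy)
  simpa using this

lemma coordAt_self (x : X) : coordAt x x = 0 := sub_self _

lemma coordAt_ne_zero {x y : X} (hy : y ∈ (chartAt ℂ x).source) (hxy : y ≠ x) :
    coordAt x y ≠ 0 :=
  sub_ne_zero.2 fun h => hxy ((chartAt ℂ x).injOn hy (mem_chart_source ℂ x) h)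

lemma eventually_coordAt_ne_zero (x : X) : ∀ᶠ y in 𝓝 x, y ≠ x → coordAt x y ≠ 0 := by
  filter_upwards [chart_source_mem_nhds ℂ x] with y hy using coordAt_ne_zero hy

lemma contMDiffAt_coordAt {x y : X} (hy : y ∈ (chartAt ℂ x).source) :
    ContMDiffAt 𝓘(ℂ, ℂ) 𝓘(ℂ, ℂ) ω (coordAt x) y := by
  have h := contMDiffAt_extChartAt' (I := 𝓘(ℂ, ℂ)) (n := ω) (x := x) (x' := y) hy
  exact h.sub contMDiffAt_const

/-- The differential of a function on `X`, as a linear map `ℂ → ℂ` in the preferred chart. -/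
def differential (g : X → ℂ) (x : X) : ℂ →L[ℂ] ℂ := mfderiv 𝓘(ℂ, ℂ) 𝓘(ℂ, ℂ) g x

/-- In the chart the quotient by `z` is the slope function `dslope`, which is analytic and takes the
derivative as its value at the centre. All divisions by `z` below go through this. -/
lemma exists_div_coordAt {g : X → ℂ} {x : X} (hg : ContMDiffAt 𝓘(ℂ, ℂ) 𝓘(ℂ, ℂ) ω g x)
    (h0 : g x = 0) : ∃ h : X → ℂ, ContMDiffAt 𝓘(ℂ, ℂ) 𝓘(ℂ, ℂ) ω h x ∧
      (∀ᶠ y in 𝓝 x, g y = coordAt x y * h y) ∧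
      differential g x 1 = h x := by
  set e := chartAt ℂ x with he
  set G : ℂ → ℂ := g ∘ e.symm with hG
  have hGc : ContDiffAt ℂ ω G (e x) := by
    have := (contMDiffAt_iff.1 hg).2
    simpa [Function.comp_def, hG, chartAt_self_eq, contDiffWithinAt_univ] using this
  obtain ⟨q, hq⟩ := hGc.analyticAt
  have hd : ContMDiffAt 𝓘(ℂ, ℂ) 𝓘(ℂ, ℂ) ω (dslope G (e x)) (e x) :=
    (AnalyticAt.contDiffAt ⟨_, hq.has_fpower_series_dslope_fslope⟩).contMDiffAt
  refine ⟨dslope G (e x) ∘ e, hd.comp x ?_, ?_, ?_⟩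
  · exact contMDiffAt_extChartAt (I := 𝓘(ℂ, ℂ)) (n := ω) (x := x)
  · filter_upwards [chart_source_mem_nhds ℂ x] with y hy
    have h1 := sub_smul_dslope G (e x) (e y)
    have h2 : G (e x) = 0 := by simp [hG, he, h0]
    have h3 : G (e y) = g y := by simp [hG, he, hy]
    rw [h2, h3, sub_zero, smul_eq_mul] at h1
    exact h1.symm
  · have hm : differential g x = fderivWithin ℂ (writtenInExtChartAt 𝓘(ℂ, ℂ) 𝓘(ℂ, ℂ) x g)
        (range 𝓘(ℂ, ℂ)) (extChartAt 𝓘(ℂ, ℂ) x x) :=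
      MDifferentiableAt.mfderiv (hg.mdifferentiableAt (by simp))
    rw [hm]
    simp only [Function.comp, dslope_same]
    rw [← fderiv_apply_one_eq_deriv]
    simp only [hG, he, writtenInExtChartAt, Function.comp_def, mfld_simps, fderivWithin_univ]
    rfl

/-- Dividing `z` by itself gives a quotient equal to `1` off `x`, hence at `x` by continuity. -/
lemma differential_coordAt (x : X) :
    differential (coordAt x) x 1 = 1 := by
  obtain ⟨h, hh, hz, hd⟩ :=
    exists_div_coordAt (contMDiffAt_coordAt (mem_chart_source ℂ x)) (coordAt_self x)
  rw [hd]
  refine eq_of_eventually_punctured hh.continuousAt (continuousAt_const (y := (1 : ℂ))) ?_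
  filter_upwards [nhdsWithin_le_nhds hz, self_mem_nhdsWithin,
    nhdsWithin_le_nhds (eventually_coordAt_ne_zero x)] with y h1 h2 h3
  exact mul_left_cancel₀ (h3 h2) (by rw [← h1, mul_one])

/-- Near a fixed point `x` of `f` at which `f` has multiplier `c ≠ 0`, the coordinate `z ∘ f` is
`z` times a holomorphic function with value `c` at `x`. -/
lemma exists_coordAt_comp (f : HolAut X) {x : X} (hx : f x = x) {c : ℂ}
    (hdf : ∀ v : TangentSpace 𝓘(ℂ, ℂ) x,
      tangentMap 𝓘(ℂ, ℂ) 𝓘(ℂ, ℂ) f ⟨x, v⟩ = ⟨x, c • v⟩) :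
    ∃ u : X → ℂ, ContMDiffAt 𝓘(ℂ, ℂ) 𝓘(ℂ, ℂ) ω u x ∧
      (∀ᶠ y in 𝓝 x, coordAt x (f y) = coordAt x y * u y) ∧ u x = c := by
  have hz : ContMDiffAt 𝓘(ℂ, ℂ) 𝓘(ℂ, ℂ) ω (coordAt x) (f x) :=
    hx.symm ▸ contMDiffAt_coordAt (mem_chart_source ℂ x)
  have hf : ContMDiffAt 𝓘(ℂ, ℂ) 𝓘(ℂ, ℂ) ω f x := f.contMDiff.contMDiffAt
  obtain ⟨u, hu, hzu, hd⟩ := exists_div_coordAt (g := fun y => coordAt x (f y)) (hz.comp x hf)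
    (by simp [hx, coordAt_self])
  refine ⟨u, hu, hzu, hd.symm.trans ?_⟩
  -- The chain rule is used on the tangent bundle, where `hdf` can be rewritten without transporting
  -- vectors along `f x = x`.
  have h1 := tangentMap_comp_at (I := 𝓘(ℂ, ℂ)) (I' := 𝓘(ℂ, ℂ)) (I'' := 𝓘(ℂ, ℂ))
    (g := coordAt x) (f := f) (⟨x, (1 : ℂ)⟩ : TangentBundle 𝓘(ℂ, ℂ) X)
    (hz.mdifferentiableAt (by simp)) (hf.mdifferentiableAt (by simp))
  rw [hdf (1 : ℂ)] at h1
  have h2 : differential (fun y => coordAt x (f y)) x 1 =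
      differential (coordAt x) x (c • (1 : ℂ)) :=
    congrArg (fun v : TangentBundle 𝓘(ℂ, ℂ) ℂ => (v.2 : ℂ)) h1
  rw [h2, map_smul, differential_coordAt, smul_eq_mul, mul_one]

/-- The differential of `f` in the coordinate vector fields near a fixed point. -/
lemma exists_mfderiv_coordVec (f : HolAut X) {x : X} (hx : f x = x) {c : ℂ}
    (hdf : ∀ v : TangentSpace 𝓘(ℂ, ℂ) x,
      tangentMap 𝓘(ℂ, ℂ) 𝓘(ℂ, ℂ) f ⟨x, v⟩ = ⟨x, c • v⟩) :
    ∃ γ : X → ℂ, ContinuousAt γ x ∧ γ x = c ∧ ∀ᶠ y in 𝓝 x,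
      mfderiv 𝓘(ℂ, ℂ) 𝓘(ℂ, ℂ) f y (coordVec x y) = γ y • coordVec x (f y) := by
  set e := trivializationAt ℂ (TangentSpace 𝓘(ℂ, ℂ) : X → Type) x with he
  have hxe : x ∈ e.baseSet := mem_baseSet_trivializationAt ℂ (TangentSpace 𝓘(ℂ, ℂ) : X → Type) x
  let V : X → TangentBundle 𝓘(ℂ, ℂ) X := fun y => ⟨y, coordVec x y⟩
  have hV : ContinuousAt V x := by
    have h1 : ContinuousAt (fun y => e.toOpenPartialHomeomorph.symm (y, (1 : ℂ))) x := by
      have := e.toOpenPartialHomeomorph.continuousAt_symm (x := (x, (1 : ℂ)))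
        (by rw [e.mem_target]; exact hxe)
      exact ContinuousAt.comp (f := fun y : X => (y, (1 : ℂ))) (x := x) this (by fun_prop)
    refine h1.congr ?_
    filter_upwards [e.open_baseSet.mem_nhds hxe] with y hy
    exact (e.mk_symm hy (1 : ℂ)).symm
  have hT : Continuous (tangentMap 𝓘(ℂ, ℂ) 𝓘(ℂ, ℂ) f) :=
    f.contMDiff.continuous_tangentMap (by simp)
  have hTx : tangentMap 𝓘(ℂ, ℂ) 𝓘(ℂ, ℂ) f (V x) = ⟨x, c • coordVec x x⟩ := hdf _
  have hsrc : tangentMap 𝓘(ℂ, ℂ) 𝓘(ℂ, ℂ) f (V x) ∈ e.source := by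
    rw [hTx, e.mem_source]; exact hxe
  -- `γ` is the fibre coordinate of the image of the coordinate vector field; its continuity comes
  -- from that of the tangent map.
  refine ⟨fun y => (e (tangentMap 𝓘(ℂ, ℂ) 𝓘(ℂ, ℂ) f (V y))).2, ?_, ?_, ?_⟩
  · have h1 : ContinuousAt (fun y => tangentMap 𝓘(ℂ, ℂ) 𝓘(ℂ, ℂ) f (V y)) x :=
      hT.continuousAt.comp hV
    exact continuousAt_snd.comp
      (ContinuousAt.comp (g := e) (e.continuousAt hsrc) h1)
  · simp only [hTx]
    have h1 : (e ⟨x, c • coordVec x x⟩).2 = e.linearMapAt ℂ x (c • coordVec x x) :=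
      (congrFun (e.coe_linearMapAt_of_mem (R := ℂ) hxe) _).symm
    rw [h1, map_smul]
    have h2 : e.linearMapAt ℂ x (coordVec x x) = 1 := by
      have := e.linearMapAt_symmₗ (R := ℂ) hxe (1 : ℂ)
      rwa [e.symmₗ_apply hxe] at this
    rw [h2, smul_eq_mul, mul_one]
  · filter_upwards [f.contMDiff.continuous.continuousAt.eventually
      (e.open_baseSet.mem_nhds (hx.symm ▸ hxe))] with y hy
    have h1 : e.symmₗ ℂ (f y) (e.linearMapAt ℂ (f y)
        (mfderiv 𝓘(ℂ, ℂ) 𝓘(ℂ, ℂ) f y (coordVec x y))) =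
        mfderiv 𝓘(ℂ, ℂ) 𝓘(ℂ, ℂ) f y (coordVec x y) := e.symmₗ_linearMapAt hy _
    have h2 : e.linearMapAt ℂ (f y) (mfderiv 𝓘(ℂ, ℂ) 𝓘(ℂ, ℂ) f y (coordVec x y)) =
        (e (tangentMap 𝓘(ℂ, ℂ) 𝓘(ℂ, ℂ) f (V y))).2 :=
      congrFun (e.coe_linearMapAt_of_mem (R := ℂ) hy) _
    rw [← h1, h2]
    conv_lhs => rw [← mul_one (e (tangentMap 𝓘(ℂ, ℂ) 𝓘(ℂ, ℂ) f (V y))).2, ← smul_eq_mul, map_smul]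
    rw [e.symmₗ_apply hy]
    rfl

/-! ### The Hecke transform -/

/-- The linear map `(a, b) ↦ (a, c b)` of `ℂ²`. -/
def diagMap (c : ℂ) : (Fin 2 → ℂ) →ₗ[ℂ] (Fin 2 → ℂ) where
  toFun w := ![w 0, c * w 1]
  map_add' v w := by ext i; fin_cases i <;> simp [mul_add]
  map_smul' a w := by ext i; fin_cases i <;> simp [mul_left_comm]

@[simp] lemma diagMap_apply_zero (c : ℂ) (w : Fin 2 → ℂ) : diagMap c w 0 = w 0 := rfl

@[simp] lemma diagMap_apply_one (c : ℂ) (w : Fin 2 → ℂ) : diagMap c w 1 = c * w 1 := rfl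

lemma diagMap_inv_apply {c : ℂ} (hc : c ≠ 0) (w : Fin 2 → ℂ) : diagMap c⁻¹ (diagMap c w) = w := by
  ext i; fin_cases i <;> simp [hc]

lemma diagMap_apply_inv {c : ℂ} (hc : c ≠ 0) (w : Fin 2 → ℂ) : diagMap c (diagMap c⁻¹ w) = w := by
  ext i; fin_cases i <;> simp [hc]

lemma det_diagMap (c : ℂ) : LinearMap.det (diagMap c) = c := by
  rw [← LinearMap.det_toMatrix', Matrix.det_fin_two]
  simp [LinearMap.toMatrix'_apply]

section
variable {M : Type*} [TopologicalSpace M] [ChartedSpace ℂ M]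

lemma contMDiffAt_fin_two {s : M → Fin 2 → ℂ} {y : M} :
    ContMDiffAt 𝓘(ℂ, ℂ) 𝓘(ℂ, Fin 2 → ℂ) ω s y ↔
      ContMDiffAt 𝓘(ℂ, ℂ) 𝓘(ℂ, ℂ) ω (fun z => s z 0) y ∧
      ContMDiffAt 𝓘(ℂ, ℂ) 𝓘(ℂ, ℂ) ω (fun z => s z 1) y := by
  rw [contMDiffAt_pi_space, Fin.forall_fin_two]

lemma contMDiffAt_vec {a b : M → ℂ} {y : M} (ha : ContMDiffAt 𝓘(ℂ, ℂ) 𝓘(ℂ, ℂ) ω a y)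
    (hb : ContMDiffAt 𝓘(ℂ, ℂ) 𝓘(ℂ, ℂ) ω b y) :
    ContMDiffAt 𝓘(ℂ, ℂ) 𝓘(ℂ, Fin 2 → ℂ) ω (fun z => ![a z, b z]) y :=
  contMDiffAt_fin_two.2 ⟨ha, hb⟩

lemma contMDiffAt_diagMap {c : M → ℂ} {s : M → Fin 2 → ℂ} {y : M}
    (hc : ContMDiffAt 𝓘(ℂ, ℂ) 𝓘(ℂ, ℂ) ω c y) (hs : ContMDiffAt 𝓘(ℂ, ℂ) 𝓘(ℂ, Fin 2 → ℂ) ω s y) :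
    ContMDiffAt 𝓘(ℂ, ℂ) 𝓘(ℂ, Fin 2 → ℂ) ω (fun z => diagMap (c z) (s z)) y :=
  contMDiffAt_vec (contMDiffAt_fin_two.1 hs).1 (hc.mul (contMDiffAt_fin_two.1 hs).2)

end

section hecke
variable (x : X) (G : (Fin 2 → ℂ) ≃ₗ[ℂ] (Fin 2 → ℂ))

open Classical in
/-- The inclusion of the Hecke transform into a bundle, in the trivializations with index `i`. -/
def twist (i y : X) : (Fin 2 → ℂ) →ₗ[ℂ] (Fin 2 → ℂ) :=
  if i = x then G.toLinearMap ∘ₗ diagMap (coordAt x y) else LinearMap.id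

open Classical in
/-- The inverse of `twist`. -/
def twistInv (i y : X) : (Fin 2 → ℂ) →ₗ[ℂ] (Fin 2 → ℂ) :=
  if i = x then diagMap (coordAt x y)⁻¹ ∘ₗ G.symm.toLinearMap else LinearMap.id

variable (E : HolBundle X 2)

open Classical in
/-- The domains of the trivializations of the Hecke transform. -/
def heckeBase (i : X) : Set X :=
  -- Only the index `x` covers the point `x`, so no genuine transition takes place there. The chart
  -- domain ensures that `z` vanishes only at `x`.
  if i = x then E.base x ∩ (chartAt ℂ x).source else E.base i \ {x}

variable {x}

lemma twistInv_twist {i y : X} (hy : y ∈ heckeBase x E i) (hyx : y ≠ x) (w : Fin 2 → ℂ) :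
    twistInv x G i y (twist x G i y w) = w := by
  by_cases h : i = x
  · rw [heckeBase, if_pos h] at hy
    simp [twistInv, twist, h, diagMap_inv_apply (coordAt_ne_zero hy.2 hyx)]
  · simp [twistInv, twist, h]

lemma twist_twistInv {i y : X} (hy : y ∈ heckeBase x E i) (hyx : y ≠ x) (w : Fin 2 → ℂ) :
    twist x G i y (twistInv x G i y w) = w := by
  by_cases h : i = x
  · rw [heckeBase, if_pos h] at hy
    simp [twistInv, twist, h, diagMap_apply_inv (coordAt_ne_zero hy.2 hyx)]
  · simp [twistInv, twist, h]

lemma heckeBase_subset {i : X} : heckeBase x E i ⊆ E.base i := by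
  intro y hy
  by_cases h : i = x
  · rw [heckeBase, if_pos h] at hy
    exact h ▸ hy.1
  · rw [heckeBase, if_neg h] at hy
    exact hy.1

lemma eq_of_mem_heckeBase {i : X} (h : x ∈ heckeBase x E i) : i = x := by
  by_contra hi
  rw [heckeBase, if_neg hi] at h
  exact h.2 rfl

lemma contMDiffAt_twist {i y : X} (hy : y ∈ heckeBase x E i) {s : X → Fin 2 → ℂ}
    (hs : ContMDiffAt 𝓘(ℂ, ℂ) 𝓘(ℂ, Fin 2 → ℂ) ω s y) :
    ContMDiffAt 𝓘(ℂ, ℂ) 𝓘(ℂ, Fin 2 → ℂ) ω (fun z => twist x G i z (s z)) y := by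
  by_cases h : i = x
  · rw [heckeBase, if_pos h] at hy
    simp only [twist, h, if_true]
    exact contMDiffAt_clm_apply G.toLinearMap
      (contMDiffAt_diagMap (contMDiffAt_coordAt hy.2) hs)
  · simpa [twist, h] using hs

lemma contMDiffAt_twistInv {i y : X} (hy : y ∈ heckeBase x E i) (hyx : y ≠ x)
    {s : X → Fin 2 → ℂ} (hs : ContMDiffAt 𝓘(ℂ, ℂ) 𝓘(ℂ, Fin 2 → ℂ) ω s y) :
    ContMDiffAt 𝓘(ℂ, ℂ) 𝓘(ℂ, Fin 2 → ℂ) ω (fun z => twistInv x G i z (s z)) y := by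
  by_cases h : i = x
  · rw [heckeBase, if_pos h] at hy
    simp only [twistInv, h, if_true]
    exact contMDiffAt_diagMap ((contMDiffAt_coordAt hy.2).inv₀ (coordAt_ne_zero hy.2 hyx))
      (contMDiffAt_clm_apply G.symm.toLinearMap hs)
  · simpa [twistInv, h] using hs

variable (x)

open Classical in
/-- The transition functions of the Hecke transform. -/
def heckeChange (i j y : X) : (Fin 2 → ℂ) →L[ℂ] (Fin 2 → ℂ) :=
  -- `twistInv` is not an inverse at `x`, where `z⁻¹` is `0` by convention. The identity is the
  -- right value because only `i = j = x` matters there.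
  if y = x then ContinuousLinearMap.id ℂ _ else
    (twistInv x G j y ∘ₗ E.triv j y ∘ₗ E.trivSymm i y ∘ₗ twist x G i y).toContinuousLinearMap

variable {x}

lemma heckeChange_apply {i j y : X} (h : y ≠ x) (w : Fin 2 → ℂ) :
    heckeChange x G E i j y w = twistInv x G j y (E.triv j y (E.trivSymm i y (twist x G i y w))) := by
  simp [heckeChange, h]

lemma heckeChange_at (i j : X) (w : Fin 2 → ℂ) : heckeChange x G E i j x w = w := by
  simp [heckeChange]

lemma heckeChange_self {i y : X} (hy : y ∈ heckeBase x E i) (w : Fin 2 → ℂ) :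
    heckeChange x G E i i y w = w := by
  by_cases h : y = x
  · rw [h, heckeChange_at]
  · rw [heckeChange_apply G E h, E.triv_trivSymm (heckeBase_subset E hy), twistInv_twist G E hy h]

variable [T2Space X]

lemma isOpen_heckeBase (i : X) : IsOpen (heckeBase x E i) := by
  by_cases h : i = x
  · rw [heckeBase, if_pos h]
    exact (E.isOpen_base x).inter (chartAt ℂ x).open_source
  · rw [heckeBase, if_neg h]
    exact (E.isOpen_base i).sdiff isClosed_singleton

lemma contMDiffOn_heckeChange (i j : X) :
    ContMDiffOn 𝓘(ℂ, ℂ) 𝓘(ℂ, (Fin 2 → ℂ) →L[ℂ] (Fin 2 → ℂ)) ω (heckeChange x G E i j)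
      (heckeBase x E i ∩ heckeBase x E j) := by
  by_cases hij : i = j
  · subst hij
    refine (contMDiffOn_const (c := ContinuousLinearMap.id ℂ (Fin 2 → ℂ))).congr fun y hy => ?_
    ext1 w
    exact heckeChange_self G E hy.1 w
  · intro y hy
    -- Overlaps of distinct trivializations avoid `x`, so `z` is invertible on them.
    have hyx : y ≠ x := by
      rintro rfl
      exact hij ((eq_of_mem_heckeBase E hy.1).trans (eq_of_mem_heckeBase E hy.2).symm)
    refine (contMDiffAt_matrix fun k => ?_).contMDiffWithinAt
    have h1 := contMDiffAt_twist G E hy.1 (contMDiffAt_const (c := (Pi.single k 1 : Fin 2 → ℂ)))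
    have h2 := (E.hol_iff_triv contMDiffAt_id (heckeBase_subset E hy.2) _).1
      (E.holAt_trivSymm (heckeBase_subset E hy.1) h1)
    refine (contMDiffAt_twistInv G E hy.2 hyx h2).congr_of_eventuallyEq ?_
    filter_upwards [isOpen_compl_singleton.mem_nhds hyx] with z hz
    exact heckeChange_apply G E hz _

variable (x)

/-- The cocycle of the Hecke transform of `E` at `x`. -/
def heckeCore : VectorBundleCore ℂ X (Fin 2 → ℂ) X where
  baseSet := heckeBase x E
  isOpen_baseSet := isOpen_heckeBase E
  indexAt := id
  mem_baseSet_at y := by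
    by_cases h : y = x
    · simp only [heckeBase, if_pos h, id]
      exact h ▸ ⟨E.mem_base y, mem_chart_source ℂ y⟩
    · simp only [heckeBase, if_neg h, id]
      exact ⟨E.mem_base y, h⟩
  coordChange := heckeChange x G E
  coordChange_self i y hy w := heckeChange_self G E hy w
  continuousOn_coordChange i j := (contMDiffOn_heckeChange G E i j).continuousOn
  coordChange_comp i j k y hy w := by
    by_cases h : y = x
    · rw [h, heckeChange_at, heckeChange_at, heckeChange_at]
    · rw [heckeChange_apply G E h, heckeChange_apply G E h, heckeChange_apply G E h,
        twist_twistInv G E hy.1.2 h, E.trivSymm_triv (heckeBase_subset E hy.1.2)]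

instance : (heckeCore x G E).IsContMDiff 𝓘(ℂ, ℂ) ω where
  contMDiffOn_coordChange i j := contMDiffOn_heckeChange G E i j

/-- The Hecke transform of `E` at `x`: with the columns of `G` as a local frame of `E` at `x`, its
sections are the sections of `E` whose second coordinate vanishes at `x`. -/
def HolBundle.hecke : HolBundle X 2 where
  fiber := (heckeCore x G E).Fiber

/-- The inclusion of the Hecke transform. -/
def HolBundle.heckeMap (y : X) : (E.hecke x G).fiber y →ₗ[ℂ] E.fiber y :=
  -- The fibre over `y` is `ℂ²` in the trivialization with index `y`, as `indexAt` is the identity.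
  (E.trivSymm y y ∘ₗ twist x G y y : (Fin 2 → ℂ) →ₗ[ℂ] E.fiber y)

lemma HolBundle.triv_hecke {i y : X} (hy : y ∈ (E.hecke x G).base i)
    (v : (E.hecke x G).fiber y) :
    (E.hecke x G).triv i y v = heckeChange x G E y i y (v : Fin 2 → ℂ) :=
  (HolBundle.triv_apply _ hy v).trans rfl

/-- In every trivialization the inclusion is `twist`: off `x` the factor `twistInv` of the cocycle
cancels, and over `x` only one index occurs. -/
lemma triv_trivSymm_twist {i y : X} (hy : y ∈ heckeBase x E i) (w : Fin 2 → ℂ) :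
    E.triv i y (E.trivSymm y y (twist x G y y w)) = twist x G i y (heckeChange x G E y i y w) := by
  by_cases h : y = x
  · subst h
    obtain rfl := eq_of_mem_heckeBase E hy
    rw [heckeChange_at, E.triv_trivSymm (E.mem_base _)]
  · rw [heckeChange_apply G E h, twist_twistInv G E hy h]

lemma HolBundle.triv_heckeMap {i y : X} (hy : y ∈ (E.hecke x G).base i)
    (v : (E.hecke x G).fiber y) :
    E.triv i y (E.heckeMap x G y v) = twist x G i y ((E.hecke x G).triv i y v) := by
  rw [E.triv_hecke x G hy]
  exact triv_trivSymm_twist x G E hy v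

lemma HolBundle.holAt_heckeMap {y : X} {s : ∀ z, (E.hecke x G).fiber z}
    (hs : (E.hecke x G).HolAt s y) : E.HolAt (fun z => E.heckeMap x G z (s z)) y := by
  have hy := (E.hecke x G).mem_base y
  refine (E.hol_iff_triv contMDiffAt_id (E.mem_base y) _).2
    ((contMDiffAt_twist G E hy ((HolBundle.hol_iff_triv _ contMDiffAt_id hy _).1 hs)
      ).congr_of_eventuallyEq ?_)
  filter_upwards [(E.hecke x G).base_mem_nhds y] with z hz
  exact E.triv_heckeMap x G hz _

lemma HolBundle.bijective_heckeMap {y : X} (hy : y ≠ x) :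
    Function.Bijective (E.heckeMap x G y) := by
  have hb : y ∈ heckeBase x E y := (E.hecke x G).mem_base y
  refine Function.bijective_iff_has_inverse.2
    ⟨fun v => (twistInv x G y y (E.triv y y v) : Fin 2 → ℂ), fun v => ?_, fun v => ?_⟩
  · have h1 : ∀ w : Fin 2 → ℂ,
        twistInv x G y y (E.triv y y (E.trivSymm y y (twist x G y y w))) = w := fun w => by
      rw [E.triv_trivSymm (E.mem_base y), twistInv_twist G E hb hy]
    exact h1 v
  · have h1 : E.trivSymm y y (twist x G y y (twistInv x G y y (E.triv y y v))) = v := by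
      rw [twist_twistInv G E hb hy, E.trivSymm_triv (E.mem_base y)]
    exact h1

lemma HolBundle.triv_heckeMap_at {y : X} (hy : y ∈ (E.hecke x G).base x)
    (v : (E.hecke x G).fiber y) :
    E.triv x y (E.heckeMap x G y v) = G (diagMap (coordAt x y) ((E.hecke x G).triv x y v)) := by
  rw [E.triv_heckeMap x G hy]
  simp [twist]

end hecke

/-! ### Elementary modifications and lifts -/

/-- `ι : E' → E` is a holomorphic map of bundles of rank two which is an isomorphism off `x` and
has the matrix `diag(1, z)` in suitable coordinates `τ'`, `τ` near `x`. -/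
structure IsModification (E' E : HolBundle X 2) (x : X) (ι : ∀ y, E'.fiber y →ₗ[ℂ] E.fiber y)
    (τ : ∀ y, E.fiber y →ₗ[ℂ] (Fin 2 → ℂ)) (σ : ∀ y, (Fin 2 → ℂ) →ₗ[ℂ] E.fiber y)
    (τ' : ∀ y, E'.fiber y →ₗ[ℂ] (Fin 2 → ℂ)) (σ' : ∀ y, (Fin 2 → ℂ) →ₗ[ℂ] E'.fiber y) :
    Prop where
  coord : IsCoordAt E x τ σ
  coord' : IsCoordAt E' x τ' σ'
  hol : ∀ y (s : ∀ y, E'.fiber y), E'.HolAt s y → E.HolAt (fun z => ι z (s z)) y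
  bij : ∀ y, y ≠ x → Function.Bijective (ι y)
  diag : ∀ᶠ y in 𝓝 x, ∀ v, τ y (ι y v) = diagMap (coordAt x y) (τ' y v)

lemma diagMap_injective {c : ℂ} (hc : c ≠ 0) : Function.Injective (diagMap c) :=
  Function.LeftInverse.injective (diagMap_inv_apply hc)

/-- A holomorphic matrix which is upper triangular at `x` remains holomorphic after conjugation by
`diag(1, z)`. -/
lemma exists_factor {x : X} {A : X → (Fin 2 → ℂ) →ₗ[ℂ] (Fin 2 → ℂ)}
    (hA : ∀ j, ContMDiffAt 𝓘(ℂ, ℂ) 𝓘(ℂ, Fin 2 → ℂ) ω (fun y => A y (Pi.single j 1)) x)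
    (h0 : A x (Pi.single 0 1) 1 = 0) {u : X → ℂ} (hu : ContMDiffAt 𝓘(ℂ, ℂ) 𝓘(ℂ, ℂ) ω u x)
    (hu0 : u x ≠ 0) :
    ∃ (k : X → ℂ) (N : X → (Fin 2 → ℂ) →ₗ[ℂ] (Fin 2 → ℂ)),
      ContMDiffAt 𝓘(ℂ, ℂ) 𝓘(ℂ, ℂ) ω k x ∧
      (∀ᶠ y in 𝓝 x, A y (Pi.single 0 1) 1 = coordAt x y * k y) ∧
      (∀ a : X → Fin 2 → ℂ, ContMDiffAt 𝓘(ℂ, ℂ) 𝓘(ℂ, Fin 2 → ℂ) ω a x →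
        ContMDiffAt 𝓘(ℂ, ℂ) 𝓘(ℂ, Fin 2 → ℂ) ω (fun y => N y (a y)) x) ∧
      (∀ᶠ y in 𝓝 x, ∀ w,
        diagMap (coordAt x y * u y) (N y w) = A y (diagMap (coordAt x y) w)) ∧
      (∀ w, N x w = ![A x (Pi.single 0 1) 0 * w 0,
        (u x)⁻¹ * (k x * w 0 + A x (Pi.single 1 1) 1 * w 1)]) := by
  have hz := contMDiffAt_coordAt (mem_chart_source ℂ x)
  have hA' := fun j => contMDiffAt_fin_two.1 (hA j)
  obtain ⟨k, hk, hzk, -⟩ := exists_div_coordAt (hA' 0).2 h0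
  -- This is `diag(1, z u)⁻¹ A diag(1, z)`. Its lower left entry is `A₁₀ / (z u) = k / u`, which is
  -- why `A₁₀` has to vanish at `x`.
  let N : X → (Fin 2 → ℂ) →ₗ[ℂ] (Fin 2 → ℂ) := fun y => Matrix.toLin'
    !![A y (Pi.single 0 1) 0, coordAt x y * A y (Pi.single 1 1) 0;
      (u y)⁻¹ * k y, (u y)⁻¹ * A y (Pi.single 1 1) 1]
  have hN : ∀ y w, N y w = ![A y (Pi.single 0 1) 0 * w 0 +
      coordAt x y * A y (Pi.single 1 1) 0 * w 1,
      (u y)⁻¹ * (k y * w 0 + A y (Pi.single 1 1) 1 * w 1)] := fun y w => by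
    ext i
    fin_cases i
    · simp [N, Matrix.mulVec, dotProduct, Fin.sum_univ_two]
    · simp [N, Matrix.mulVec, dotProduct, Fin.sum_univ_two]
      ring
  refine ⟨k, N, hk, hzk, fun a ha => ?_, ?_, fun w => ?_⟩
  · simp only [hN]
    have ha' := contMDiffAt_fin_two.1 ha
    exact contMDiffAt_vec (((hA' 0).1.mul ha'.1).add ((hz.mul (hA' 1).1).mul ha'.2))
      ((hu.inv₀ hu0).mul ((hk.mul ha'.1).add ((hA' 1).2.mul ha'.2)))
  · filter_upwards [hzk, hu.continuousAt.eventually_ne hu0] with y hy hu1 w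
    have hw : A y (diagMap (coordAt x y) w) = w 0 • A y (Pi.single 0 1) +
        (coordAt x y * w 1) • A y (Pi.single 1 1) := by
      rw [← map_smul, ← map_smul, ← map_add]
      congr 1
      ext i
      fin_cases i <;> simp
    rw [hw, hN]
    ext i
    fin_cases i
    · simp
      ring
    · simp [hy]
      field_simp
  · rw [hN, coordAt_self]; simp

open Classical in
/-- The inverse of a linear map, or zero. -/
def linInv {V W : Type*} [AddCommGroup V] [Module ℂ V] [AddCommGroup W] [Module ℂ W]
    (φ : V →ₗ[ℂ] W) : W →ₗ[ℂ] V :=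
  if h : Function.Bijective φ then (LinearEquiv.ofBijective φ h).symm.toLinearMap else 0

section
variable {V W : Type*} [AddCommGroup V] [Module ℂ V] [AddCommGroup W] [Module ℂ W]
  {φ : V →ₗ[ℂ] W}

lemma linInv_apply (h : Function.Bijective φ) (v : V) : linInv φ (φ v) = v := by
  rw [linInv, dif_pos h]
  exact LinearEquiv.symm_apply_apply (LinearEquiv.ofBijective φ h) v

lemma apply_linInv (h : Function.Bijective φ) (w : W) : φ (linInv φ w) = w := by
  rw [linInv, dif_pos h]
  exact LinearEquiv.apply_symm_apply (LinearEquiv.ofBijective φ h) w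

end

/-- In the total space the transport along `f x = x` hidden in `atFixed` disappears. -/
lemma EquivBundle.atFixed_eq {f : HolAut X} {r : ℕ} (E : EquivBundle f r) {x : X} (hx : f x = x)
    (v : E.fiber x) : (⟨x, E.atFixed hx v⟩ : E.Total) = ⟨f x, E.lift x v⟩ := by
  unfold EquivBundle.atFixed
  have : ∀ (y : X) (h : y = x) (w : E.fiber y),
      (⟨x, LinearEquiv.cast (R := ℂ) (M := E.fiber) h w⟩ : E.Total) = ⟨y, w⟩ := by
    rintro y rfl w
    rfl
  exact this _ hx _

/-- In coordinates, `f_E(x)` is given by the lift. -/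
lemma EquivBundle.coord_atFixed {f : HolAut X} {r : ℕ} (E : EquivBundle f r) {x : X}
    (hx : f x = x) (τ : ∀ y, E.fiber y →ₗ[ℂ] (Fin r → ℂ)) (v : E.fiber x) :
    τ x (E.atFixed hx v) = τ (f x) (E.lift x v) :=
  congrArg (fun v : E.Total => τ v.1 v.2) (E.atFixed_eq hx v)

lemma IsCoordAt.holAt_symm {r : ℕ} {E : HolBundle X r} {x : X}
    {τ : ∀ y, E.fiber y →ₗ[ℂ] (Fin r → ℂ)} {σ : ∀ y, (Fin r → ℂ) →ₗ[ℂ] E.fiber y}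
    (h : IsCoordAt E x τ σ) {a : X → Fin r → ℂ}
    (ha : ContMDiffAt 𝓘(ℂ, ℂ) 𝓘(ℂ, Fin r → ℂ) ω a x) : E.HolAt (fun y => σ y (a y)) x := by
  refine (h.hol_iff id x contMDiffAt_id rfl _).2 (ha.congr_of_eventuallyEq ?_)
  filter_upwards [h.right] with y hy using hy _

lemma EquivBundle.contMDiffAt_lift {f : HolAut X} {r : ℕ} (E : EquivBundle f r) {y : X}
    {s : ∀ y, E.fiber y} (hs : E.HolAt s y) :
    ContMDiffAt 𝓘(ℂ, ℂ) (𝓘(ℂ, ℂ).prod 𝓘(ℂ, Fin r → ℂ)) ω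
      (fun y => (⟨f y, E.lift y (s y)⟩ : E.Total)) y :=
  holAt_map E.lift E.lift_holomorphic.contMDiffAt hs

/-- The matrix of the lift near a fixed point. -/
def EquivBundle.liftMatrix {f : HolAut X} {r : ℕ} (E : EquivBundle f r)
    (τ : ∀ y, E.fiber y →ₗ[ℂ] (Fin r → ℂ)) (σ : ∀ y, (Fin r → ℂ) →ₗ[ℂ] E.fiber y) (y : X) :
    (Fin r → ℂ) →ₗ[ℂ] (Fin r → ℂ) :=
  τ (f y) ∘ₗ E.lift y ∘ₗ σ y

section
variable {f : HolAut X} {r : ℕ} (E : EquivBundle f r) {x : X}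
  {τ : ∀ y, E.fiber y →ₗ[ℂ] (Fin r → ℂ)} {σ : ∀ y, (Fin r → ℂ) →ₗ[ℂ] E.fiber y}

lemma EquivBundle.contMDiffAt_liftMatrix (h : IsCoordAt E.toHolBundle x τ σ) (hx : f x = x)
    (j : Fin r) : ContMDiffAt 𝓘(ℂ, ℂ) 𝓘(ℂ, Fin r → ℂ) ω
      (fun y => E.liftMatrix τ σ y (Pi.single j 1)) x :=
  (h.hol_iff f x f.contMDiff.contMDiffAt hx _).1
    (E.contMDiffAt_lift (h.holAt_symm contMDiffAt_const))

lemma EquivBundle.liftMatrix_at (hx : f x = x)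
    (w : Fin r → ℂ) : E.liftMatrix τ σ x w = τ x (E.atFixed hx (σ x w)) :=
  (E.coord_atFixed hx τ _).symm

lemma EquivBundle.liftMatrix_apply (h : IsCoordAt E.toHolBundle x τ σ) :
    ∀ᶠ y in 𝓝 x, ∀ v, E.liftMatrix τ σ y (τ y v) = τ (f y) (E.lift y v) := by
  filter_upwards [h.left] with y hy v
  simp [liftMatrix, hy]

end

lemma tendsto_fixed (f : HolAut X) {x : X} (hx : f x = x) : Tendsto f (𝓝 x) (𝓝 x) := by
  have := f.contMDiff.continuous.tendsto x
  rwa [hx] at this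

lemma ne_fixed (f : HolAut X) {x y : X} (hx : f x = x) (hy : y ≠ x) : f y ≠ x :=
  fun h => hy (f.injective (h.trans hx.symm))

/-- The part of the total space off the fibre over `x` is dense, because the projection is open and
`x` is not isolated; the total space is Hausdorff. -/
lemma HolBundle.eq_id_of_continuous [T2Space X] {r : ℕ} (E : HolBundle X r) {x : X}
    {g : E.Total → E.Total} (hg : Continuous g) (h : ∀ v, v.1 ≠ x → g v = v) : g = id := by
  have hd : Dense {v : E.Total | v.1 ≠ x} :=
    (dense_compl_singleton x).preimage (FiberBundle.isOpenMap_proj (Fin r → ℂ) E.fiber)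
  exact hg.ext_on hd continuous_id h

namespace IsModification

variable {E' : HolBundle X 2} {x : X} {f : HolAut X}

section
variable {E : HolBundle X 2}
  {ι : ∀ y, E'.fiber y →ₗ[ℂ] E.fiber y}
  {τ : ∀ y, E.fiber y →ₗ[ℂ] (Fin 2 → ℂ)} {σ : ∀ y, (Fin 2 → ℂ) →ₗ[ℂ] E.fiber y}
  {τ' : ∀ y, E'.fiber y →ₗ[ℂ] (Fin 2 → ℂ)} {σ' : ∀ y, (Fin 2 → ℂ) →ₗ[ℂ] E'.fiber y}

/-- Away from `x` the inclusion is a local isomorphism, so holomorphy in `E'` can be tested in `E`.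
-/
lemma contMDiffAt_iff (h : IsModification E' E x ι τ σ τ' σ') {g : X → X} {y : X}
    (hg : ContMDiffAt 𝓘(ℂ, ℂ) 𝓘(ℂ, ℂ) ω g y) (hy : g y ≠ x) (s : ∀ y, E'.fiber (g y)) :
    ContMDiffAt 𝓘(ℂ, ℂ) (𝓘(ℂ, ℂ).prod 𝓘(ℂ, Fin 2 → ℂ)) ω
        (fun y => (⟨g y, s y⟩ : E'.Total)) y ↔
      ContMDiffAt 𝓘(ℂ, ℂ) (𝓘(ℂ, ℂ).prod 𝓘(ℂ, Fin 2 → ℂ)) ω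
        (fun y => (⟨g y, ι (g y) (s y)⟩ : E.Total)) y := by
  refine ⟨fun hs => ?_, fun hs => contMDiffAt_of_map ι hg (fun s => h.hol (g y) s)
    (h.bij _ hy).injective hs⟩
  exact (contMDiffAt_total (g := id) ι ⟨g y, s y⟩ contMDiffAt_id
    (fun t ht => h.hol (g y) t ht)).comp y hs

lemma holAt_iff (h : IsModification E' E x ι τ σ τ' σ') {y : X} (hy : y ≠ x)
    (s : ∀ y, E'.fiber y) : E'.HolAt s y ↔ E.HolAt (fun z => ι z (s z)) y :=
  h.contMDiffAt_iff contMDiffAt_id hy s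

lemma contMDiff_total (h : IsModification E' E x ι τ σ τ' σ') :
    ContMDiff (𝓘(ℂ, ℂ).prod 𝓘(ℂ, Fin 2 → ℂ)) (𝓘(ℂ, ℂ).prod 𝓘(ℂ, Fin 2 → ℂ)) ω
      (totalMap E' E ι) := fun v =>
  contMDiffAt_total (g := id) ι v contMDiffAt_id fun s hs => h.hol _ s hs

lemma diag_at (h : IsModification E' E x ι τ σ τ' σ') (v : E'.fiber x) :
    τ x (ι x v) = ![τ' x v 0, 0] := by
  rw [h.diag.self_of_nhds v, coordAt_self]
  ext i; fin_cases i <;> simp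

end

variable {E : EquivBundle f 2}
  {ι : ∀ y, E'.fiber y →ₗ[ℂ] E.fiber y}
  {τ : ∀ y, E.fiber y →ₗ[ℂ] (Fin 2 → ℂ)} {σ : ∀ y, (Fin 2 → ℂ) →ₗ[ℂ] E.fiber y}
  {τ' : ∀ y, E'.fiber y →ₗ[ℂ] (Fin 2 → ℂ)} {σ' : ∀ y, (Fin 2 → ℂ) →ₗ[ℂ] E'.fiber y}

/-- A lift of `f` to a bundle, which is diagonal at a fixed point `x` in the given coordinates,
induces a lift to the modification. -/
lemma exists_lift (h : IsModification E' E.toHolBundle x ι τ σ τ' σ') (hx : f x = x)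
    {c μ : ℂ} (hc : c ≠ 0) (hdf : ∀ v : TangentSpace 𝓘(ℂ, ℂ) x,
      tangentMap 𝓘(ℂ, ℂ) 𝓘(ℂ, ℂ) f ⟨x, v⟩ = ⟨x, c • v⟩)
    (hE : ∀ v, τ x (E.atFixed hx v) = diagMap μ (τ x v)) :
    ∃ (l : ∀ y, E'.fiber y →ₗ[ℂ] E'.fiber (f y)) (k : ℂ),
      ContMDiff (𝓘(ℂ, ℂ).prod 𝓘(ℂ, Fin 2 → ℂ)) (𝓘(ℂ, ℂ).prod 𝓘(ℂ, Fin 2 → ℂ)) ω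
        (E'.totalLift f l) ∧
      (∀ y v, ι (f y) (l y v) = E.lift y (ι y v)) ∧
      (∀ v, τ' (f x) (l x v) = ![τ' x v 0, c⁻¹ * (k * τ' x v 0 + μ * τ' x v 1)]) := by
  classical
  have hfh : ∀ y, ContMDiffAt 𝓘(ℂ, ℂ) 𝓘(ℂ, ℂ) ω f y := fun y => f.contMDiff.contMDiffAt
  have hft := tendsto_fixed f hx
  obtain ⟨u, hu, hzu, hux⟩ := exists_coordAt_comp f hx hdf
  have hAx : ∀ w, E.liftMatrix τ σ x w = diagMap μ w := fun w => by
    rw [E.liftMatrix_at hx, hE, h.coord.right.self_of_nhds w]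
  obtain ⟨k, N, -, -, hNh, hN, hNx⟩ := exists_factor (E.contMDiffAt_liftMatrix h.coord hx)
    (by simp [hAx]) hu (hux ▸ hc)
  -- Off `x` the lift is forced by intertwining with `ι`; at `x`, where `ι` is not invertible, it is
  -- the value of the holomorphic matrix `N`.
  let l : ∀ y, E'.fiber y →ₗ[ℂ] E'.fiber (f y) := fun y =>
    if y = x then σ' (f y) ∘ₗ N y ∘ₗ τ' y else linInv (ι (f y)) ∘ₗ E.lift y ∘ₗ ι y
  have hfx : ∀ y, y ≠ x → f y ≠ x := fun y hy => ne_fixed f hx hy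
  have hl1 : ∀ y, y ≠ x → ∀ v, ι (f y) (l y v) = E.lift y (ι y v) := fun y hy v => by
    simp only [l, if_neg hy]
    exact apply_linInv (h.bij _ (hfx y hy)) _
  -- The two definitions fit together: off `x` the factor `diag(1, z∘f)` is injective and cancels,
  -- so `N` is the matrix of `l` on a whole neighbourhood of `x`.
  have hτl : ∀ᶠ y in 𝓝 x, ∀ v, τ' (f y) (l y v) = N y (τ' y v) := by
    filter_upwards [hft.eventually h.coord'.right, hft.eventually h.diag, h.diag, hzu, hN,
      hft.eventually (eventually_coordAt_ne_zero x), E.liftMatrix_apply h.coord]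
      with y h1 h2 h3 h4 h5 h6 h7 v
    by_cases hy : y = x
    · simp only [l, if_pos hy]
      exact h1 _
    · refine diagMap_injective (h6 (hfx y hy)) ?_
      rw [← h2, hl1 y hy, h4, h5, ← h3, h7]
  have hl2 : ∀ y v, ι (f y) (l y v) = E.lift y (ι y v) := by
    intro y v
    by_cases hy : y = x
    swap; · exact hl1 y hy v
    subst hy
    refine Function.LeftInverse.injective (hft.eventually h.coord.left).self_of_nhds ?_
    rw [(hft.eventually h.diag).self_of_nhds, hτl.self_of_nhds, hzu.self_of_nhds,
      hN.self_of_nhds, ← h.diag.self_of_nhds, (E.liftMatrix_apply h.coord).self_of_nhds]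
  refine ⟨l, k x, fun v => contMDiffAt_total l v (hfh _) fun s hs => ?_, hl2, fun v => ?_⟩
  · by_cases hy : v.1 = x
    · rw [hy] at hs ⊢
      refine (h.coord'.hol_iff f x (hfh x) hx _).2
        ((hNh _ ((h.coord'.hol_iff id x contMDiffAt_id rfl _).1 hs)).congr_of_eventuallyEq ?_)
      filter_upwards [hτl] with y hy using hy _
    · refine (h.contMDiffAt_iff (hfh _) (hfx _ hy) _).2 ?_
      simp only [hl2]
      exact E.contMDiffAt_lift (h.hol _ _ hs)
  · rw [hτl.self_of_nhds, hNx, hux, hAx, hAx]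
    simp

lemma iterate_totalLift (l : ∀ y, E'.fiber y →ₗ[ℂ] E'.fiber (f y))
    (hl : ∀ y v, ι (f y) (l y v) = E.lift y (ι y v)) (n : ℕ) (v : E'.Total) :
    totalMap E' E.toHolBundle ι ((E'.totalLift f l)^[n] v) =
      (E.totalLift f E.lift)^[n] (totalMap E' E.toHolBundle ι v) := by
  refine Function.Semiconj.iterate_right (fun w => ?_) n v
  exact congrArg (TotalSpace.mk (f w.1)) (hl w.1 w.2)

/-- The induced lift has the same order. -/
lemma lift_order [T2Space X] (h : IsModification E' E.toHolBundle x ι τ σ τ' σ')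
    (l : ∀ y, E'.fiber y →ₗ[ℂ] E'.fiber (f y))
    (hl : ∀ y v, ι (f y) (l y v) = E.lift y (ι y v)) (hc : Continuous (E'.totalLift f l)) :
    (E'.totalLift f l)^[orderOf f.toEquiv] = id := by
  -- Off `x` the relation descends from `E` because `ι` is injective there.
  refine E'.eq_id_of_continuous (x := x) (hc.iterate _) fun v hv => ?_
  have h1 := iterate_totalLift l hl (orderOf f.toEquiv) v
  rw [E.lift_order] at h1
  have hinj : ∀ w : E'.Total, totalMap E' E.toHolBundle ι w = totalMap E' E.toHolBundle ι v →
      w = v := by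
    rintro ⟨y, w⟩ hw
    obtain rfl : y = v.1 := congrArg TotalSpace.proj hw
    have h2 : ι v.1 w = ι v.1 v.2 := by simpa [totalMap] using hw
    exact congrArg (TotalSpace.mk v.1) ((h.bij _ hv).injective h2)
  exact hinj _ h1

end IsModification

/-! ### Higgs fields on modifications -/

/-- Both extensions of `z Φ(∂/∂z) s` agree off `x`, hence at `x`; every vector of the fibre is the
value of some local holomorphic section `s`. -/
lemma HolBundle.HasResidue.unique [T2Space X] {r : ℕ} {E : HolBundle X r} {Φ : E.HiggsField}
    {x : X} {R S : Module.End ℂ (E.fiber x)} (hR : E.HasResidue Φ x R)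
    (hS : E.HasResidue Φ x S) : R = S := by
  classical
  refine LinearMap.ext fun v => ?_
  have hs : E.HolAt (fun y => E.trivSymm x y (E.triv x x v)) x :=
    E.holAt_trivSymm (E.mem_base x) contMDiffAt_const
  have h1 := (hR _ hs).eq_at (hS _ hs) (by
    filter_upwards [self_mem_nhdsWithin] with y hy
    rw [Function.update_of_ne hy, Function.update_of_ne hy])
  simpa [E.trivSymm_triv (E.mem_base x)] using h1

namespace IsModification

variable {E' : HolBundle X 2} {x : X} {E : HolBundle X 2}
  {ι : ∀ y, E'.fiber y →ₗ[ℂ] E.fiber y}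
  {τ : ∀ y, E.fiber y →ₗ[ℂ] (Fin 2 → ℂ)} {σ : ∀ y, (Fin 2 → ℂ) →ₗ[ℂ] E.fiber y}
  {τ' : ∀ y, E'.fiber y →ₗ[ℂ] (Fin 2 → ℂ)} {σ' : ∀ y, (Fin 2 → ℂ) →ₗ[ℂ] E'.fiber y}
  {Φ : E.HiggsField} {Φ' : E'.HiggsField}

lemma higgsHolAt [T2Space X] (h : IsModification E' E x ι τ σ τ' σ')
    (hΦ : ∀ y, y ≠ x → ∀ v w, ι y (Φ' y v w) = Φ y v (ι y w)) {y : X} (hy : y ≠ x)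
    (hol : E.HiggsHolAt Φ y) : E'.HiggsHolAt Φ' y := by
  intro s hs
  refine (h.holAt_iff hy _).2 ((hol _ ((h.holAt_iff hy _).1 hs)).congr ?_)
  filter_upwards [isOpen_compl_singleton.mem_nhds hy] with z hz using hΦ z hz _ _

lemma hasResidue [T2Space X] (h : IsModification E' E x ι τ σ τ' σ')
    (hΦ : ∀ y, y ≠ x → ∀ v w, ι y (Φ' y v w) = Φ y v (ι y w)) {y : X} (hy : y ≠ x)
    {R : Module.End ℂ (E.fiber y)} {R' : Module.End ℂ (E'.fiber y)}
    (hR' : ∀ v, ι y (R' v) = R (ι y v)) (hR : E.HasResidue Φ y R) : E'.HasResidue Φ' y R' := by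
  classical
  intro s hs
  refine (h.holAt_iff hy _).2 ((hR _ ((h.holAt_iff hy _).1 hs)).congr ?_)
  filter_upwards [isOpen_compl_singleton.mem_nhds hy] with z hz
  by_cases hzy : z = y
  · subst hzy
    simp [hR']
  · rw [Function.update_of_ne hzy, Function.update_of_ne hzy, map_smul, hΦ z hz]

/-- A Higgs field which is holomorphic at `x` has a simple pole on the modification, with
residue strictly lower triangular. -/
lemma exists_residue (h : IsModification E' E x ι τ σ τ' σ')
    (hΦ : ∀ y, y ≠ x → ∀ v w, ι y (Φ' y v w) = Φ y v (ι y w))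
    (hext : ∃ A, E.HiggsExtends Φ x A) :
    ∃ (P : X → (Fin 2 → ℂ) →ₗ[ℂ] (Fin 2 → ℂ)) (R : Module.End ℂ (E'.fiber x)),
      (∀ j, ContMDiffAt 𝓘(ℂ, ℂ) 𝓘(ℂ, Fin 2 → ℂ) ω (fun y => P y (Pi.single j 1)) x) ∧
      (∀ᶠ y in 𝓝 x, y ≠ x → ∀ v, τ y (Φ y (coordVec x y) v) = P y (τ y v)) ∧
      E'.HasResidue Φ' x R ∧
      (∀ v, τ' x (R v) = ![0, P x (Pi.single 0 1) 1 * τ' x v 0]) := by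
  classical
  obtain ⟨A, hA⟩ := hext
  let P : X → (Fin 2 → ℂ) →ₗ[ℂ] (Fin 2 → ℂ) := fun y =>
    τ y ∘ₗ (Function.update Φ x A y (coordVec x y)) ∘ₗ σ y
  have hP : ∀ j, ContMDiffAt 𝓘(ℂ, ℂ) 𝓘(ℂ, Fin 2 → ℂ) ω (fun y => P y (Pi.single j 1)) x := by
    intro j
    exact (h.coord.hol_iff id x contMDiffAt_id rfl _).1
      (hA _ (h.coord.holAt_symm contMDiffAt_const))
  have hPΦ : ∀ᶠ y in 𝓝 x, y ≠ x → ∀ v, τ y (Φ y (coordVec x y) v) = P y (τ y v) := by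
    filter_upwards [h.coord.left] with y hy hyx v
    simp [P, hy, Function.update_of_ne hyx]
  have hz := contMDiffAt_coordAt (mem_chart_source ℂ x)
  -- Here `u = 1` and the matrix is `z P`, which vanishes at `x`. Hence `N x` retains only the entry
  -- `k x`, the quotient of `z P₁₀` by `z`.
  obtain ⟨k, N, hk, hzk, hNh, hN, hNx⟩ := exists_factor (A := fun y => coordAt x y • P y)
    (u := fun _ => 1) (fun j => hz.smul (hP j)) (by simp [coordAt_self]) contMDiffAt_const
    one_ne_zero
  have hkx : k x = P x (Pi.single 0 1) 1 := by
    refine eq_of_eventually_punctured hk.continuousAt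
      (contMDiffAt_fin_two.1 (hP 0)).2.continuousAt ?_
    filter_upwards [self_mem_nhdsWithin, nhdsWithin_le_nhds (eventually_coordAt_ne_zero x),
      nhdsWithin_le_nhds hzk] with y h1 h2 h3
    exact mul_left_cancel₀ (h2 h1) h3.symm
  refine ⟨P, σ' x ∘ₗ N x ∘ₗ τ' x, hP, hPΦ, fun s hs => ?_, fun v => ?_⟩
  · refine (h.coord'.hol_iff id x contMDiffAt_id rfl _).2
      ((hNh _ ((h.coord'.hol_iff id x contMDiffAt_id rfl _).1 hs)).congr_of_eventuallyEq ?_)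
    filter_upwards [hN, hPΦ, h.diag, h.coord'.right, eventually_coordAt_ne_zero x]
      with y h1 h2 h3 h4 h5
    by_cases hy : y = x
    · subst hy
      simp only [id, Function.update_self]
      exact h4 _
    · simp only [id, Function.update_of_ne hy]
      refine diagMap_injective (h5 hy) ?_
      rw [← h3, map_smul, map_smul, hΦ y hy, h2 hy, h3]
      simpa using (h1 (τ' y (s y))).symm
  · simp only [LinearMap.comp_apply]
    rw [h.coord'.right.self_of_nhds, hNx, ← hkx]
    simp [coordAt_self]

end IsModification

/-- Equivariance of the Higgs field, in the limit at a fixed point. -/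
lemma EquivHiggs.weight_eq [T2Space X] {f : HolAut X} {D : Finset X} (E : EquivHiggs f D) {x : X}
    (hx : f x = x) {τ : ∀ y, E.fiber y →ₗ[ℂ] (Fin 2 → ℂ)}
    {σ : ∀ y, (Fin 2 → ℂ) →ₗ[ℂ] E.fiber y} (h : IsCoordAt E.toHolBundle x τ σ) {c μ : ℂ}
    (hdf : ∀ v : TangentSpace 𝓘(ℂ, ℂ) x,
      tangentMap 𝓘(ℂ, ℂ) 𝓘(ℂ, ℂ) f ⟨x, v⟩ = ⟨x, c • v⟩)
    (hE : ∀ v, τ x (E.atFixed hx v) = diagMap μ (τ x v))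
    {P : X → (Fin 2 → ℂ) →ₗ[ℂ] (Fin 2 → ℂ)}
    (hP : ∀ j, ContMDiffAt 𝓘(ℂ, ℂ) 𝓘(ℂ, Fin 2 → ℂ) ω (fun y => P y (Pi.single j 1)) x)
    (hPΦ : ∀ᶠ y in 𝓝 x, y ≠ x → ∀ v, τ y (E.Φ y (coordVec x y) v) = P y (τ y v)) :
    μ * P x (Pi.single 0 1) 1 = c * P x (Pi.single 0 1) 1 := by
  obtain ⟨γ, hγ, hγx, hγe⟩ := exists_mfderiv_coordVec f hx hdf
  have hft := tendsto_fixed f hx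
  set A := E.liftMatrix τ σ with hAdef
  have hA := E.contMDiffAt_liftMatrix h hx
  have hAx : ∀ w, A x w = diagMap μ w := fun w => by
    rw [hAdef, E.liftMatrix_at hx, hE, h.right.self_of_nhds w]
  have hPc : ContinuousAt (fun y => (P y).toContinuousLinearMap) x :=
    (contMDiffAt_matrix hP).continuousAt
  have hAc : ContinuousAt (fun y => (A y).toContinuousLinearMap) x :=
    (contMDiffAt_matrix hA).continuousAt
  have hPf : ContinuousAt (fun y => (P (f y)).toContinuousLinearMap) x := by
    refine ContinuousAt.comp (g := fun y => (P y).toContinuousLinearMap) ?_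
      f.contMDiff.continuous.continuousAt
    rwa [hx]
  have e0 : ContinuousAt (fun _ : X => (Pi.single 0 1 : Fin 2 → ℂ)) x := continuousAt_const
  have h1 := (continuous_apply (1 : Fin 2)).continuousAt.comp (hAc.clm_apply (hPc.clm_apply e0))
  have h2 := (continuous_apply (1 : Fin 2)).continuousAt.comp
    (hγ.smul (hPf.clm_apply (hAc.clm_apply e0)))
  -- Equivariance of `Φ` is available only off `D`; as `D` is finite, this covers a punctured
  -- neighbourhood of `x`.
  have hD : ∀ᶠ y in 𝓝[≠] x, y ∉ D := by
    have h3 : ((D : Set X) \ {x})ᶜ ∈ 𝓝 x :=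
      ((D.finite_toSet.subset sdiff_subset).isClosed.isOpen_compl).mem_nhds (by simp)
    filter_upwards [nhdsWithin_le_nhds h3, self_mem_nhdsWithin] with y h4 h5 h6
    exact h4 ⟨h6, h5⟩
  -- Near `x`, equivariance reads `A P = γ (P∘f) A`. Its lower left entry at `x`, where `A = diag(1,
  -- μ)` and `γ = c`, is the claim.
  have h3 := eq_of_eventually_punctured h1 h2 (by
    filter_upwards [hD, self_mem_nhdsWithin, nhdsWithin_le_nhds hPΦ,
      nhdsWithin_le_nhds (hft.eventually hPΦ), nhdsWithin_le_nhds hγe,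
      nhdsWithin_le_nhds h.right, nhdsWithin_le_nhds (E.liftMatrix_apply h)]
      with y h1 h2 h3 h4 h5 h6 h7
    have h8 := E.higgs_equivariant y h1 (coordVec x y) (σ y (Pi.single 0 1))
    have h9 := congrArg (τ (f y)) h8
    rw [h5, ← h7, h3 h2, h6, map_smul, LinearMap.smul_apply, map_smul,
      h4 (ne_fixed f hx h2)] at h9
    exact congrFun h9 1)
  simp only [Function.comp, Pi.smul_apply', LinearMap.coe_toContinuousLinearMap', hAx, hγx, hx]
    at h3
  have h4 : diagMap μ (Pi.single 0 1) = Pi.single 0 1 := by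
    ext i; fin_cases i <;> simp
  rw [h4] at h3
  simpa using h3

/-! ### Kernels of evaluation maps and determinants -/

lemma EquivHom.holAt_map {f : HolAut X} {r r' : ℕ} {E' : EquivBundle f r'} {E : EquivBundle f r}
    (φ : EquivHom E' E) {s : ∀ y, E'.fiber y} {y : X} (hs : E'.HolAt s y) :
    E.HolAt (fun z => φ.map z (s z)) y :=
  HeckeHiggs.holAt_map (g := id) φ.map φ.holomorphic.contMDiffAt hs

lemma HolBundle.HolAt.of_map {f : HolAut X} {r : ℕ} {E' E : EquivBundle f r} {φ : EquivHom E' E}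
    {s : ∀ y, E'.fiber y} {y : X} (hs : E.HolAt (fun z => φ.map z (s z)) y)
    (hy : Function.Injective (φ.map y)) : E'.HolAt s y :=
  contMDiffAt_of_map (g := id) φ.map contMDiffAt_id (fun _ => φ.holAt_map) hy hs

/-- Off `x` a section has exactly one lift, which is holomorphic, so the only thing to supply is a
holomorphic lift near `x`. -/
lemma isSectionKernel_of_local [T2Space X] {f : HolAut X} {r : ℕ} {E' E : EquivBundle f r}
    (φ : EquivHom E' E) {x : X} {W : Submodule ℂ (E.fiber x)}
    (hb : ∀ y, y ≠ x → Function.Bijective (φ.map y)) (hr : ∀ v, φ.map x v ∈ W)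
    (hs : ∀ s : ∀ y, E.fiber y, E.HolAt s x → s x ∈ W →
      ∃ t : ∀ y, E'.fiber y, E'.HolAt t x ∧ ∀ᶠ y in 𝓝 x, φ.map y (t y) = s y) :
    IsSectionKernel φ x W where
  injective U hU s t hsU htU h y hy := by
    by_cases hyx : y = x
    · subst hyx
      refine (hsU y hy).eq_at (htU y hy) ?_
      filter_upwards [self_mem_nhdsWithin, nhdsWithin_le_nhds (hU.mem_nhds hy)] with z hz hzU
      exact (hb z hz).injective (h z hzU)
    · exact (hb y hyx).injective (h y hy)
  exact U hU s hsU := by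
    classical
    rw [Submodule.mkQ_apply, Submodule.Quotient.mk_eq_zero]
    refine ⟨fun ⟨t, _, ht⟩ hx => ht x hx ▸ hr _, fun hW => ?_⟩
    obtain ⟨t₀, ht₀⟩ : ∃ t : ∀ y, E'.fiber y, x ∈ U →
        E'.HolAt t x ∧ ∀ᶠ y in 𝓝 x, φ.map y (t y) = s y := by
      by_cases hx : x ∈ U
      · obtain ⟨t, ht⟩ := hs s (hsU x hx) (hW hx)
        exact ⟨t, fun _ => ht⟩
      · exact ⟨fun _ => 0, fun h => absurd h hx⟩
    -- Of the local lift `t₀` only the value at `x` is kept. Near `x` the two agree anyway, since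
    -- lifts are unique off `x`.
    let t : ∀ y, E'.fiber y := fun y => if y = x then t₀ y else linInv (φ.map y) (s y)
    have ht : ∀ y ∈ U, φ.map y (t y) = s y := by
      intro y hy
      by_cases hyx : y = x
      · subst hyx
        simpa [t] using (ht₀ hy).2.self_of_nhds
      · simpa [t, hyx] using apply_linInv (hb y hyx) (s y)
    refine ⟨t, fun y hy => ?_, ht⟩
    by_cases hyx : y = x
    · subst hyx
      refine (ht₀ hy).1.congr ?_
      filter_upwards [(ht₀ hy).2] with z hz
      by_cases hzx : z = y
      · simp [t, hzx]
      · simp [t, hzx, ← hz, linInv_apply (hb z hzx)]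
    · refine HolBundle.HolAt.of_map (φ := φ) ((hsU y hy).congr ?_) (hb y hyx).injective
      filter_upwards [hU.mem_nhds hy] with z hz using ht z hz

lemma evalSurjective {f : HolAut X} {r : ℕ} (E : EquivBundle f r) (x : X)
    (W : Submodule ℂ (E.fiber x)) : EvalSurjective E x W := by
  intro w
  obtain ⟨v, rfl⟩ := W.mkQ_surjective w
  refine ⟨E.base x, E.isOpen_base x, E.mem_base x, fun y => E.trivSymm x y (E.triv x x v),
    fun y hy => E.holAt_trivSymm hy contMDiffAt_const, ?_⟩
  exact congrArg W.mkQ (E.trivSymm_triv (E.mem_base x) v)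

/-- The map of determinant lines induced by a linear map of fibres. -/
def detFiberMap {r : ℕ} (E' E : HolBundle X r) {y : X} (φ : E'.fiber y →ₗ[ℂ] E.fiber y) :
    E'.det.fiber y →ₗ[ℂ] E.det.fiber y :=
  (LinearMap.det ((E.coord y).toLinearMap ∘ₗ φ ∘ₗ (E'.coord y).symm.toLinearMap) •
    LinearMap.id : (Fin 1 → ℂ) →ₗ[ℂ] (Fin 1 → ℂ))

/-- The fibre over a point of the domain in the coordinates of the trivialization at `x`. -/
def HolBundle.trivEquiv {r : ℕ} (E : HolBundle X r) {x y : X} (hy : y ∈ E.base x) :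
    E.fiber y ≃ₗ[ℂ] (Fin r → ℂ) :=
  LinearEquiv.ofLinearMap (E.triv x y) (E.trivSymm x y)
    (LinearMap.ext (E.triv_trivSymm hy)) (LinearMap.ext (E.trivSymm_triv hy))

lemma HolBundle.coord_apply {r : ℕ} (E : HolBundle X r) (y : X) (v : E.fiber y) :
    E.coord y v = E.triv y y v :=
  (E.triv_apply (E.mem_base y) v).symm

lemma HolBundle.det_triv {r : ℕ} (E : HolBundle X r) {x y : X} (hy : y ∈ E.base x)
    (v : E.det.fiber y) :
    E.det.triv x y v = (LinearMap.det (((E.coord y).symm.trans (E.trivEquiv hy)).toLinearMap) •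
      (v : Fin 1 → ℂ) : Fin 1 → ℂ) := by
  rw [HolBundle.triv_apply E.det (show y ∈ E.det.base x from hy), E.det_triv_apply]
  have hi : ∀ z, MemTrivializationAtlas (E.detCore.indexAt z).1 :=
    fun z => ⟨(E.detCore.indexAt z).2⟩
  have := hi y
  have := hi x
  rw [E.detChange_eq (E.detCore.indexAt y) (E.detCore.indexAt x) y
      (E.detCore.mem_baseSet_at y) hy]
  have h2 : E.coordOf (E.detCore.indexAt x).1 y hy = E.trivEquiv hy :=
    LinearEquiv.ext fun w => (E.triv_apply hy w).symm
  rw [h2]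
  rfl

/-- Passing to the trivializations at `x` multiplies by transition determinants on either side;
multiplicativity of `det` absorbs them. -/
lemma det_triv_detFiberMap {r : ℕ} {E' E : HolBundle X r} {x y : X}
    (φ : E'.fiber y →ₗ[ℂ] E.fiber y) (hy' : y ∈ E'.base x) (hy : y ∈ E.base x)
    (v : E'.det.fiber y) :
    E.det.triv x y (detFiberMap E' E φ v) =
      LinearMap.det (E.triv x y ∘ₗ φ ∘ₗ E'.trivSymm x y) • E'.det.triv x y v := by
  rw [E.det_triv hy, E'.det_triv hy']
  have hs : ∀ (a b c d : ℂ) (u : Fin 1 → ℂ), a * b = c * d → a • b • u = c • d • u := by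
    intro a b c d u h
    rw [smul_smul, smul_smul, h]
  refine hs _ (LinearMap.det ((E.coord y).toLinearMap ∘ₗ φ ∘ₗ (E'.coord y).symm.toLinearMap))
    _ _ v ?_
  rw [← LinearMap.det_comp, ← LinearMap.det_comp]
  congr 1
  refine LinearMap.ext fun w => ?_
  simp [HolBundle.trivEquiv, E'.trivSymm_triv hy']

section
variable {f : HolAut X} {r : ℕ} {E' E : EquivBundle f r}

/-- The morphism of determinant line bundles induced by a morphism. -/
def EquivHom.det (φ : EquivHom E' E) : EquivHom E'.det E.det where
  map y := detFiberMap E'.toHolBundle E.toHolBundle (φ.map y)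
  holomorphic v := by
    refine contMDiffAt_total (E := E'.det.toHolBundle) (E' := E.det.toHolBundle) (g := id)
      (fun y => detFiberMap E'.toHolBundle E.toHolBundle (φ.map y)) v contMDiffAt_id
      fun s hs => ?_
    refine (HolBundle.hol_iff_triv _ contMDiffAt_id (HolBundle.mem_base _ v.1) _).2 ?_
    have h1 := (HolBundle.hol_iff_triv _ contMDiffAt_id (HolBundle.mem_base _ v.1) _).1 hs
    have h2 : ContMDiffAt 𝓘(ℂ, ℂ) 𝓘(ℂ, ℂ) ω (fun y => LinearMap.det
        (E.triv v.1 y ∘ₗ φ.map y ∘ₗ E'.trivSymm v.1 y)) v.1 :=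
      contMDiffAt_det fun j =>
        (HolBundle.hol_iff_triv _ contMDiffAt_id (HolBundle.mem_base _ v.1) _).1
          (φ.holAt_map (E'.holAt_trivSymm (HolBundle.mem_base _ v.1) contMDiffAt_const))
    refine (h2.smul h1).congr_of_eventuallyEq ?_
    filter_upwards [E'.base_mem_nhds v.1, E.base_mem_nhds v.1] with y hy' hy
    exact det_triv_detFiberMap (φ.map y) hy' hy _
  equivariant y v := by
    have hs : ∀ (a b c d : ℂ) (u : Fin 1 → ℂ), a * b = c * d → a • b • u = c • d • u := by
      intro a b c d u h
      rw [smul_smul, smul_smul, h]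
    refine hs (LinearMap.det ((E.coord (f y)).toLinearMap ∘ₗ φ.map (f y) ∘ₗ
        (E'.coord (f y)).symm.toLinearMap))
      (LinearMap.det ((E'.coord (f y)).toLinearMap ∘ₗ E'.lift y ∘ₗ
        (E'.coord y).symm.toLinearMap))
      (LinearMap.det ((E.coord (f y)).toLinearMap ∘ₗ E.lift y ∘ₗ
        (E.coord y).symm.toLinearMap))
      (LinearMap.det ((E.coord y).toLinearMap ∘ₗ φ.map y ∘ₗ
        (E'.coord y).symm.toLinearMap)) v ?_
    rw [← LinearMap.det_comp, ← LinearMap.det_comp]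
    congr 1
    refine LinearMap.ext fun w => ?_
    simp [φ.equivariant]

lemma EquivHom.bijective_det (φ : EquivHom E' E) {y : X} (hy : Function.Bijective (φ.map y)) :
    Function.Bijective (φ.det.map y) := by
  let e := ((E'.coord y).symm.trans (LinearEquiv.ofBijective (φ.map y) hy)).trans (E.coord y)
  have he : (E.coord y).toLinearMap ∘ₗ φ.map y ∘ₗ (E'.coord y).symm.toLinearMap =
      e.toLinearMap := LinearMap.ext fun w => rfl
  have hd : LinearMap.det ((E.coord y).toLinearMap ∘ₗ φ.map y ∘ₗ
      (E'.coord y).symm.toLinearMap) ≠ 0 := by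
    rw [he]
    exact (LinearEquiv.isUnit_det' e).ne_zero
  have hb : Function.Bijective ((LinearMap.det ((E.coord y).toLinearMap ∘ₗ φ.map y ∘ₗ
      (E'.coord y).symm.toLinearMap) • LinearMap.id : (Fin 1 → ℂ) →ₗ[ℂ] (Fin 1 → ℂ))) :=
    (MulAction.bijective₀ (α := Fin 1 → ℂ) hd)
  exact hb

/-- Composition of morphisms. -/
def EquivHom.comp {r₁ r₂ r₃ : ℕ} {E₁ : EquivBundle f r₁} {E₂ : EquivBundle f r₂}
    {E₃ : EquivBundle f r₃} (ψ : EquivHom E₂ E₃) (φ : EquivHom E₁ E₂) : EquivHom E₁ E₃ where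
  map y := ψ.map y ∘ₗ φ.map y
  holomorphic := ψ.holomorphic.comp φ.holomorphic
  equivariant y v := by simp [ψ.equivariant, φ.equivariant]

lemma EquivIso.refl (E : EquivBundle f r) : EquivIso E E :=
  ⟨⟨fun _ => LinearMap.id, contMDiff_id, fun _ _ => rfl⟩,
    ⟨fun _ => LinearMap.id, contMDiff_id, fun _ _ => rfl⟩, fun _ _ => rfl, fun _ _ => rfl⟩

end

/-- The determinant of an elementary modification is the twist `det E (-x)`. -/
lemma isTwistDown_det [T2Space X] {f : HolAut X} {E' E : EquivBundle f 2} {L : EquivBundle f 1}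
    (hL : EquivIso E.det L) (φ : EquivHom E' E) {x : X} (G : (Fin 2 → ℂ) ≃ₗ[ℂ] (Fin 2 → ℂ))
    (hb : ∀ y, y ≠ x → Function.Bijective (φ.map y))
    (hG : ∀ᶠ y in 𝓝 x, ∀ v, E.triv x y (φ.map y v) =
      G (diagMap (coordAt x y) (E'.triv x y v))) : IsTwistDown E'.det L x := by
  obtain ⟨ψ, χ, h1, h2⟩ := hL
  have hψ : ∀ y, Function.Bijective (ψ.map y) := fun y =>
    Function.bijective_iff_has_inverse.2 ⟨χ.map y, h1 y, h2 y⟩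
  set d : ℂ := LinearMap.det G.toLinearMap with hd
  have hd0 : d ≠ 0 := (LinearEquiv.isUnit_det' G).ne_zero
  -- The induced map on determinants is `det G · z` in local coordinates: it vanishes at `x` to
  -- first order exactly.
  have hdet : ∀ᶠ y in 𝓝 x, ∀ v, E.det.triv x y (φ.det.map y v) =
      (d * coordAt x y) • E'.det.triv x y v := by
    filter_upwards [hG, E'.base_mem_nhds x, E.base_mem_nhds x] with y hy h' h v
    have hm : E.triv x y ∘ₗ φ.map y ∘ₗ E'.trivSymm x y =
        G.toLinearMap ∘ₗ diagMap (coordAt x y) := LinearMap.ext fun w => by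
      simp [hy, E'.triv_trivSymm h']
    have := det_triv_detFiberMap (φ.map y) h' h v
    rwa [hm, LinearMap.det_comp, det_diagMap] at this
  have hinj : ∀ᶠ y in 𝓝 x, Function.Injective (E.det.triv x y) := by
    filter_upwards [E.det.base_mem_nhds x] with y hy
    exact Function.LeftInverse.injective (E.det.trivSymm_triv hy)
  refine ⟨ψ.comp φ.det, isSectionKernel_of_local _
    (fun y hy => (hψ y).comp (φ.bijective_det (hb y hy))) (fun v => ?_) fun s hs hs0 => ?_⟩
  · have h3 : φ.det.map x v = 0 := hinj.self_of_nhds (by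
      rw [hdet.self_of_nhds, coordAt_self, mul_zero, zero_smul, map_zero])
    rw [Submodule.mem_bot]
    exact (congrArg (ψ.map x) h3).trans (map_zero _)
  · rw [Submodule.mem_bot] at hs0
    have ha := (HolBundle.hol_iff_triv _ contMDiffAt_id (E.det.mem_base x) _).1 (χ.holAt_map hs)
    obtain ⟨h, hh, hz, -⟩ := exists_div_coordAt (contMDiffAt_pi_space.1 ha 0)
      (by simp [hs0])
    -- The section is moved to `det E` by `χ` and divided by `d z`.
    refine ⟨fun y => E'.det.trivSymm x y (fun _ => d⁻¹ * h y),
      E'.det.holAt_trivSymm (E'.det.mem_base x)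
        (contMDiffAt_pi_space.2 fun _ => contMDiffAt_const.mul hh), ?_⟩
    filter_upwards [hdet, hinj, hz, E'.det.base_mem_nhds x] with y h3 h4 h5 h6
    have h7 : φ.det.map y (E'.det.trivSymm x y (fun _ => d⁻¹ * h y)) = χ.map y (s y) := by
      refine h4 ?_
      rw [h3, E'.det.triv_trivSymm h6]
      ext i
      fin_cases i
      refine Eq.trans ?_ h5.symm
      simp
      field_simp
    exact (congrArg (ψ.map y) h7).trans (h2 y _)

/-! ### The modified Higgs bundle -/

/-- Two eigenvectors for the eigenvalues `1 ≠ μ` diagonalize an endomorphism of a plane. -/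
lemma exists_diagonalization {V : Type*} [AddCommGroup V] [Module ℂ V]
    (e : V ≃ₗ[ℂ] (Fin 2 → ℂ)) (a : Module.End ℂ V) {μ : ℂ} (hμ : μ ≠ 1)
    (h1 : a.HasEigenvalue 1) (h2 : a.HasEigenvalue μ) :
    ∃ B : (Fin 2 → ℂ) ≃ₗ[ℂ] V, ∀ w, a (B w) = B (diagMap μ w) := by
  obtain ⟨v, hv⟩ := h1.exists_hasEigenvector
  obtain ⟨u, hu⟩ := h2.exists_hasEigenvector
  have hav : a v = v := by simpa using hv.apply_eq_smul
  have hau : a u = μ • u := hu.apply_eq_smul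
  let T : (Fin 2 → ℂ) →ₗ[ℂ] V :=
    (LinearMap.proj 0).smulRight v + (LinearMap.proj 1).smulRight u
  have hT : ∀ w, T w = w 0 • v + w 1 • u := fun w => rfl
  have hTa : ∀ w, a (T w) = T (diagMap μ w) := fun w => by
    rw [hT, hT, map_add, map_smul, map_smul, hav, hau, smul_smul, mul_comm]
    rfl
  have hinj : Function.Injective T := by
    rw [← LinearMap.ker_eq_bot, LinearMap.ker_eq_bot']
    intro w hw
    have h3 : T (diagMap μ w) = 0 := by rw [← hTa, hw, map_zero]
    rw [hT] at hw h3
    -- Subtracting the relation `w₀ v + w₁ u = 0` from its image under `a` eliminates `v`.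
    have h4 : ((μ - 1) * w 1) • u = 0 := by
      have h5 := sub_eq_zero.2 (h3.trans hw.symm)
      simp only [diagMap_apply_zero, diagMap_apply_one] at h5
      rw [← h5]
      module
    have hw1 : w 1 = 0 := by
      simpa [sub_ne_zero.2 hμ, hu.2] using h4
    have hw0 : w 0 = 0 := by
      simpa [hw1, hv.2] using hw
    ext i
    fin_cases i
    · exact hw0
    · exact hw1
  have : FiniteDimensional ℂ V := e.symm.finiteDimensional
  exact ⟨T.linearEquivOfInjective hinj e.symm.finrank_eq, hTa⟩

/-- The constant matrix `G` is absorbed into the coordinates on `E`, which leaves the pure form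
`diag(1, z)`. -/
lemma HolBundle.isModification_hecke [T2Space X] (E : HolBundle X 2) (x : X)
    (G : (Fin 2 → ℂ) ≃ₗ[ℂ] (Fin 2 → ℂ)) :
    IsModification (E.hecke x G) E x (E.heckeMap x G)
      (fun y => G.symm.toLinearMap ∘ₗ E.triv x y) (fun y => E.trivSymm x y ∘ₗ G.toLinearMap)
      ((E.hecke x G).triv x) ((E.hecke x G).trivSymm x) where
  coord := E.isCoordAt_triv.comp G
  coord' := (E.hecke x G).isCoordAt_triv
  hol _ _ hs := E.holAt_heckeMap x G hs
  bij _ hy := E.bijective_heckeMap x G hy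
  diag := by
    filter_upwards [(E.hecke x G).base_mem_nhds x] with y hy v
    simp [E.triv_heckeMap_at x G hy]

lemma lift_injective {f : HolAut X} {r : ℕ} {E : HolBundle X r}
    {l : ∀ y, E.fiber y →ₗ[ℂ] E.fiber (f y)} {n : ℕ} (hn : n ≠ 0)
    (hl : (E.totalLift f l)^[n] = id) (y : X) : Function.Injective (l y) := by
  have h1 : Function.Injective (E.totalLift f l) := by
    obtain ⟨m, rfl⟩ := Nat.exists_eq_succ_of_ne_zero hn
    rw [Function.iterate_succ] at hl
    exact Function.Injective.of_comp (f := (E.totalLift f l)^[m])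
      (hl ▸ Function.injective_id)
  intro v w h
  have h2 : (⟨y, v⟩ : E.Total) = ⟨y, w⟩ := h1 (congrArg (TotalSpace.mk (f y)) h)
  simpa using h2

/-- The Higgs field induced by `Φ` on a modification. -/
def modHiggs {E' E : HolBundle X 2} (ι : ∀ y, E'.fiber y →ₗ[ℂ] E.fiber y) (Φ : E.HiggsField) :
    E'.HiggsField := fun y =>
  -- Where `ι y` is not bijective this is zero; it is used with `x ∈ D`, where the value of the
  -- Higgs field is irrelevant.
  { toFun := fun v => linInv (ι y) ∘ₗ Φ y v ∘ₗ ι y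
    map_add' := fun v w => by ext; simp
    map_smul' := fun c v => by ext; simp }

namespace IsModification

variable {E' : HolBundle X 2} {x : X} {f : HolAut X} {D : Finset X} {E : EquivHiggs f D}
  {ι : ∀ y, E'.fiber y →ₗ[ℂ] E.fiber y}
  {τ : ∀ y, E.fiber y →ₗ[ℂ] (Fin 2 → ℂ)} {σ : ∀ y, (Fin 2 → ℂ) →ₗ[ℂ] E.fiber y}
  {τ' : ∀ y, E'.fiber y →ₗ[ℂ] (Fin 2 → ℂ)} {σ' : ∀ y, (Fin 2 → ℂ) →ₗ[ℂ] E'.fiber y}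
  {l : ∀ y, E'.fiber y →ₗ[ℂ] E'.fiber (f y)}

lemma map_modHiggs (h : IsModification E' E.toHolBundle x ι τ σ τ' σ') (y : X) (hy : y ≠ x)
    (v : TangentSpace 𝓘(ℂ, ℂ) y) (w : E'.fiber y) :
    ι y (modHiggs ι E.Φ y v w) = E.Φ y v (ι y w) :=
  apply_linInv (h.bij y hy) _

lemma mem_comap_iff (h : IsModification E' E.toHolBundle x ι τ σ τ' σ')
    (hF : ∀ v, v ∈ E.F x ↔ τ x v 0 = 0) (v : E'.fiber x) :
    v ∈ (E.F x).comap (ι x) ↔ τ' x v 0 = 0 := by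
  rw [Submodule.mem_comap, hF, h.diag_at]
  rfl

/-- Preimages of flags are lines at `x` too: the image of `ι x` is the line where the second
coordinate vanishes and meets `E.F x` only in zero, so the preimage is the kernel of `ι x`. -/
lemma finrank_comap (h : IsModification E' E.toHolBundle x ι τ σ τ' σ')
    (hF : ∀ v, v ∈ E.F x ↔ τ x v 0 = 0) {y : X} (hy : y ∈ D) :
    Module.finrank ℂ ((E.F y).comap (ι y)) = 1 := by
  by_cases hyx : y = x
  · subst hyx
    refine finrank_eq_one_iff'.2 ⟨⟨σ' y (Pi.single 1 1), ?_⟩, fun h0 => ?_, fun w => ?_⟩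
    · rw [h.mem_comap_iff hF, h.coord'.right.self_of_nhds]
      simp
    · have h1 := congrArg (fun v => τ' y v.1) h0
      simp only [h.coord'.right.self_of_nhds] at h1
      simpa using congrFun h1 1
    · refine ⟨τ' y w.1 1, Subtype.ext ?_⟩
      have hw := (h.mem_comap_iff hF w.1).1 w.2
      refine Function.LeftInverse.injective h.coord'.left.self_of_nhds ?_
      simp only [Submodule.coe_smul, map_smul, h.coord'.right.self_of_nhds]
      ext i
      fin_cases i
      · simp [hw]
      · simp
  · let e := LinearEquiv.ofBijective (ι y) (h.bij y hyx)
    have h1 : (E.F y).comap (ι y) = (E.F y).map e.symm.toLinearMap :=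
      (Submodule.map_equiv_eq_comap_symm e.symm (E.F y)).symm
    rw [h1, LinearEquiv.finrank_map_eq]
    exact E.isHiggs.flag y hy

/-- The quasi-parabolic Higgs bundle on a modification. -/
def higgs [T2Space X] (h : IsModification E' E.toHolBundle x ι τ σ τ' σ')
    (hf : orderOf f.toEquiv ≠ 0) (hxD : x ∈ D)
    (hlh : ContMDiff (𝓘(ℂ, ℂ).prod 𝓘(ℂ, Fin 2 → ℂ)) (𝓘(ℂ, ℂ).prod 𝓘(ℂ, Fin 2 → ℂ)) ω
      (E'.totalLift f l))
    (hl : ∀ y v, ι (f y) (l y v) = E.lift y (ι y v))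
    (hF : ∀ v, v ∈ E.F x ↔ τ x v 0 = 0) (hΦ : ∃ A, E.HiggsExtends E.Φ x A) : EquivHiggs f D where
  toHolBundle := E'
  lift := l
  lift_holomorphic := hlh
  lift_order := h.lift_order l hl hlh.continuous
  F y := (E.F y).comap (ι y)
  Φ := modHiggs ι E.Φ
  isHiggs :=
    { flag := fun y hy => h.finrank_comap hF hy
      traceFree := fun y hy v => by
        let e := LinearEquiv.ofBijective (ι y) (h.bij y fun hyx => hy (hyx ▸ hxD))
        have h1 : modHiggs ι E.Φ y v = e.symm.conj (E.Φ y v) := by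
          refine LinearMap.ext fun w => e.injective ?_
          refine (h.map_modHiggs y (fun hyx => hy (hyx ▸ hxD)) v w).trans ?_
          simp [LinearEquiv.conj_apply, e]
        rw [h1, LinearMap.trace_conj']
        exact E.isHiggs.traceFree y hy v
      holomorphic := fun y hy => h.higgsHolAt h.map_modHiggs (fun hyx => hy (hyx ▸ hxD))
        (E.isHiggs.holomorphic y hy)
      nilpotentResidue := fun y hy => by
        by_cases hyx : y = x
        · subst hyx
          obtain ⟨P, R, -, -, hR, hRτ⟩ := h.exists_residue h.map_modHiggs hΦ
          refine ⟨R, hR, fun v => ?_, fun v hv => ?_⟩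
          · rw [h.mem_comap_iff hF, hRτ]
            rfl
          · refine Function.LeftInverse.injective h.coord'.left.self_of_nhds ?_
            rw [hRτ, (h.mem_comap_iff hF v).1 hv, map_zero]
            simp
        · obtain ⟨R, hR, h1, h2⟩ := E.isHiggs.nilpotentResidue y hy
          have hR' : ∀ v, ι y ((linInv (ι y) ∘ₗ R ∘ₗ ι y) v) = R (ι y v) := fun v =>
            apply_linInv (h.bij y hyx) _
          refine ⟨linInv (ι y) ∘ₗ R ∘ₗ ι y, h.hasResidue h.map_modHiggs hyx hR' hR,
            fun v => ?_, fun v hv => ?_⟩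
          · rw [Submodule.mem_comap, hR']
            exact h1 _
          · refine (h.bij y hyx).injective ?_
            rw [hR', map_zero]
            exact h2 _ hv }
  marked_fixed := E.marked_fixed
  flag_equivariant y hy := by
    have hfy : f y ∈ D := (E.marked_fixed y hy).symm ▸ hy
    have hli := lift_injective hf (h.lift_order l hl hlh.continuous) y
    have h2 : Module.finrank ℂ ((E.F (f y)).comap (ι (f y))) = 1 := h.finrank_comap hF hfy
    -- Intertwining gives one inclusion of the flags; equality follows because the lift is injective
    -- and both sides are lines.
    have : FiniteDimensional ℂ ((E.F (f y)).comap (ι (f y))) :=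
      Module.finite_of_finrank_pos (by omega)
    refine Submodule.eq_of_le_of_finrank_eq ?_ ?_
    · rintro _ ⟨v, hv, rfl⟩
      rw [Submodule.mem_comap, hl, ← E.flag_equivariant y hy]
      exact ⟨_, hv, rfl⟩
    · rw [h2, ← h.finrank_comap hF hy]
      exact (Submodule.equivMapOfInjective (l y) hli _).finrank_eq.symm
  higgs_equivariant y hy v w := by
    have hyx : y ≠ x := fun hyx => hy (hyx ▸ hxD)
    have hfyx : f y ≠ x := ne_fixed f (E.marked_fixed x hxD) hyx
    refine (h.bij _ hfyx).injective ?_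
    rw [hl, h.map_modHiggs y hyx, h.map_modHiggs _ hfyx, hl]
    exact E.higgs_equivariant y hy v (ι y w)

/-- The inclusion of a modification, as a morphism of Higgs bundles. -/
def higgsHom [T2Space X] (h : IsModification E' E.toHolBundle x ι τ σ τ' σ')
    (hf : orderOf f.toEquiv ≠ 0) (hxD : x ∈ D)
    (hlh : ContMDiff (𝓘(ℂ, ℂ).prod 𝓘(ℂ, Fin 2 → ℂ)) (𝓘(ℂ, ℂ).prod 𝓘(ℂ, Fin 2 → ℂ)) ω
      (E'.totalLift f l))
    (hl : ∀ y v, ι (f y) (l y v) = E.lift y (ι y v))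
    (hF : ∀ v, v ∈ E.F x ↔ τ x v 0 = 0) (hΦ : ∃ A, E.HiggsExtends E.Φ x A) :
    HiggsHom (h.higgs hf hxD hlh hl hF hΦ) E where
  map := ι
  holomorphic := h.contMDiff_total
  equivariant := hl
  map_flag _ _ := Submodule.map_comap_le _ _
  map_higgs y hy := h.map_modHiggs y fun hyx => hy (hyx ▸ hxD)

lemma isIsoOn_higgsHom [T2Space X] (h : IsModification E' E.toHolBundle x ι τ σ τ' σ')
    (hf : orderOf f.toEquiv ≠ 0) (hxD : x ∈ D)
    (hlh : ContMDiff (𝓘(ℂ, ℂ).prod 𝓘(ℂ, Fin 2 → ℂ)) (𝓘(ℂ, ℂ).prod 𝓘(ℂ, Fin 2 → ℂ)) ω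
      (E'.totalLift f l))
    (hl : ∀ y v, ι (f y) (l y v) = E.lift y (ι y v))
    (hF : ∀ v, v ∈ E.F x ↔ τ x v 0 = 0) (hΦ : ∃ A, E.HiggsExtends E.Φ x A) :
    (h.higgsHom hf hxD hlh hl hF hΦ).IsIsoOn {x}ᶜ := by
  have hr : ∀ y ∈ ({x}ᶜ : Set X), ∀ v, ι y (linInv (ι y) v) = v := fun y hy v =>
    apply_linInv (h.bij y hy) v
  refine ⟨fun y => linInv (ι y), fun y hy v => linInv_apply (h.bij y hy) v, hr,
    fun v hv => (ContMDiffAt.contMDiffWithinAt ?_), fun y hy hfy v => ?_, fun y hy _ => ?_,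
    fun y hy hyD v w => ?_⟩
  · refine contMDiffAt_total (E := E.toHolBundle) (E' := E') (g := id) (fun y => linInv (ι y)) v
      contMDiffAt_id fun s hs => ?_
    refine (h.holAt_iff hv _).2 (HolBundle.HolAt.congr hs ?_)
    filter_upwards [isOpen_compl_singleton.mem_nhds hv] with y hy using hr y hy _
  · refine (h.bij _ hfy).injective ((hr _ hfy _).trans ?_)
    refine Eq.trans ?_ (hl y _).symm
    exact congrArg (E.lift y) (hr y hy v).symm
  · rintro _ ⟨v, hv, rfl⟩
    change ι y (linInv (ι y) v) ∈ E.F y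
    rwa [hr y hy]
  · refine (h.bij _ hy).injective ((hr _ hy _).trans ?_)
    refine Eq.trans ?_ (h.map_modHiggs y hy v _).symm
    exact congrArg (E.Φ y v) (hr y hy w).symm

/-- The sections of a modification are the sections of the given bundle with value at `x` in the
line spanned by the first coordinate vector. -/
lemma isSectionKernel [T2Space X] {E₁ E₂ : EquivBundle f 2} {φ : EquivHom E₁ E₂}
    {τ : ∀ y, E₂.fiber y →ₗ[ℂ] (Fin 2 → ℂ)} {σ : ∀ y, (Fin 2 → ℂ) →ₗ[ℂ] E₂.fiber y}
    {τ' : ∀ y, E₁.fiber y →ₗ[ℂ] (Fin 2 → ℂ)} {σ' : ∀ y, (Fin 2 → ℂ) →ₗ[ℂ] E₁.fiber y}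
    (h : IsModification E₁.toHolBundle E₂.toHolBundle x φ.map τ σ τ' σ')
    {W : Submodule ℂ (E₂.fiber x)} (hW : ∀ v, v ∈ W ↔ τ x v 1 = 0) : IsSectionKernel φ x W := by
  refine isSectionKernel_of_local φ h.bij (fun v => ?_) fun s hs hsW => ?_
  · rw [hW, h.diag_at]
    rfl
  · have ha := contMDiffAt_fin_two.1 ((h.coord.hol_iff id x contMDiffAt_id rfl _).1 hs)
    obtain ⟨k, hk, hz, -⟩ := exists_div_coordAt ha.2 ((hW _).1 hsW)
    -- The second coordinate of `s` vanishes at `x`; dividing it by `z` inverts `diag(1, z)`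
    -- holomorphically.
    refine ⟨fun y => σ' y ![τ y (s y) 0, k y],
      h.coord'.holAt_symm (contMDiffAt_vec ha.1 hk), ?_⟩
    filter_upwards [h.coord.left, h.coord'.right, h.diag, hz] with y h1 h2 h3 h4
    refine Function.LeftInverse.injective h1 ?_
    rw [h3, h2]
    ext i
    fin_cases i
    · simp
    · simpa using h4.symm

lemma range_at (h : IsModification E' E.toHolBundle x ι τ σ τ' σ') (v : E.fiber x) :
    v ∈ LinearMap.range (ι x) ↔ τ x v 1 = 0 := by
  refine ⟨?_, fun hv => ⟨σ' x ![τ x v 0, 0], ?_⟩⟩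
  · rintro ⟨w, rfl⟩
    rw [h.diag_at]
    rfl
  · refine Function.LeftInverse.injective h.coord.left.self_of_nhds ?_
    rw [h.diag_at, h.coord'.right.self_of_nhds]
    ext i
    fin_cases i
    · simp
    · simpa using hv.symm

lemma ker_at (h : IsModification E' E.toHolBundle x ι τ σ τ' σ') (v : E'.fiber x) :
    v ∈ LinearMap.ker (ι x) ↔ τ' x v 0 = 0 := by
  rw [LinearMap.mem_ker, ← (Function.LeftInverse.injective h.coord.left.self_of_nhds).eq_iff,
    map_zero, h.diag_at]
  refine ⟨fun h1 => congrFun h1 0, fun h1 => ?_⟩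
  rw [h1]
  simp

end IsModification

/-- Eigenspaces of a lower triangular endomorphism of a plane with diagonal entries `1` and `ν`. -/
lemma eigenspaces_of_triangular {V : Type*} [AddCommGroup V] [Module ℂ V]
    {τ : V →ₗ[ℂ] (Fin 2 → ℂ)} (hτ : Function.Bijective τ) {a : Module.End ℂ V} {k ν : ℂ}
    (ha : ∀ v, τ (a v) = ![τ v 0, k * τ v 0 + ν * τ v 1]) {F : Submodule ℂ V}
    (hF : ∀ v, v ∈ F ↔ τ v 0 = 0) :
    F ≤ a.eigenspace ν ∧ (ν ≠ 1 → F = a.eigenspace ν) ∧ a.HasEigenvalue 1 ∧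
      ∀ v, a v - v ∈ F := by
  have hle : F ≤ a.eigenspace ν := fun v hv => by
    rw [Module.End.mem_eigenspace_iff]
    refine hτ.injective ?_
    have h0 := (hF v).1 hv
    rw [ha, map_smul]
    ext i
    fin_cases i <;> simp [h0]
  refine ⟨hle, fun hν => le_antisymm hle fun v hv => ?_, ?_, fun v => ?_⟩
  · rw [Module.End.mem_eigenspace_iff] at hv
    have h1 := congrFun (congrArg τ hv) 0
    rw [ha, map_smul] at h1
    have h2 : (1 - ν) * τ v 0 = 0 := by
      have h3 : τ v 0 = ν * τ v 0 := h1
      linear_combination h3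
    exact (hF v).2 ((mul_eq_zero.1 h2).resolve_left (sub_ne_zero.2 hν.symm))
  -- For `ν = 1` the endomorphism may be a Jordan block, so the eigenvector is taken in `F`.
  -- Otherwise the second coordinate solves `k + ν t = t`.
  · obtain ⟨w, hw0, hw⟩ : ∃ w : Fin 2 → ℂ, w ≠ 0 ∧ k * w 0 + ν * w 1 = w 1 := by
      by_cases hν : ν = 1
      · exact ⟨![0, 1], fun h => one_ne_zero (congrFun h 1), by simp [hν]⟩
      · refine ⟨![1, k / (1 - ν)], fun h => one_ne_zero (congrFun h 0), ?_⟩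
        have : 1 - ν ≠ 0 := sub_ne_zero.2 (Ne.symm hν)
        simp
        field_simp
        ring
    obtain ⟨v, rfl⟩ := hτ.surjective w
    refine Module.End.hasEigenvalue_of_hasEigenvector
      (x := v) ⟨Module.End.mem_eigenspace_iff.2 (hτ.injective ?_), fun h => hw0 (by simp [h])⟩
    rw [ha, hw, one_smul]
    ext i
    fin_cases i <;> rfl
  · rw [hF, map_sub, ha]
    simp

end HeckeHiggs

end

/-! ### The eigenframe at `x` and the assembly of the theorem -/

theorem mainTheorem9 {X : Type*} [TopologicalSpace X] [T2Space X] [CompactSpace X]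
    [ConnectedSpace X] [ChartedSpace ℂ X] [IsManifold 𝓘(ℂ, ℂ) ω X]
    (f : HolAut X) (p : ℕ) (hp : p.Prime) (hf : orderOf f.toEquiv = p)
    (ζ : ℂ) (hζ : IsPrimitiveRoot ζ p)
    (D : Finset X) (E : EquivHiggs f D) (L : EquivBundle f 1)
    (hL : EquivIso E.toEquivBundle.det L)
    (x : X) (hxD : x ∈ D) (hx : f x = x)
    (n : ℕ) (hn : 1 ≤ n ∧ n ≤ p - 1)
    (hdf : ∀ v : TangentSpace 𝓘(ℂ, ℂ) x,
      tangentMap 𝓘(ℂ, ℂ) 𝓘(ℂ, ℂ) f ⟨x, v⟩ = ⟨x, ζ ^ n • v⟩)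
    (b : ℕ) (hb : 1 ≤ b ∧ b ≤ p - 1)
    (hΦ : ∃ A, E.HiggsExtends E.Φ x A)
    (h1 : Module.End.HasEigenvalue (E.atFixed hx) 1)
    (hζb : Module.End.HasEigenvalue (E.atFixed hx) (ζ ^ b))
    (hF : E.F x = Module.End.eigenspace (E.atFixed hx) (ζ ^ b)) :
    ∃ (E' : EquivHiggs f D) (ι : HiggsHom E' E),
      (∃ L' : EquivBundle f 1, IsTwistDown L' L x ∧ EquivIso E'.toEquivBundle.det L') ∧
      ι.IsIsoOn {x}ᶜ ∧
      LinearMap.range (ι.map x) = Module.End.eigenspace (E.atFixed hx) 1 ∧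
      LinearMap.ker (ι.map x) = E'.F x ∧
      E'.F x ≤ Module.End.eigenspace (E'.atFixed hx) (ζ ^ ((b : ℤ) - n)) ∧
      (b ≠ n → E'.F x = Module.End.eigenspace (E'.atFixed hx) (ζ ^ ((b : ℤ) - n))) ∧
      Module.End.HasEigenvalue (E'.atFixed hx) 1 ∧
      (∀ v, E'.atFixed hx v - v ∈ E'.F x) ∧
      (∃ R : Module.End ℂ (E'.fiber x), E'.HasResidue E'.Φ x R ∧
        (∀ v, R v ∈ E'.F x) ∧ (∀ v ∈ E'.F x, R v = 0)) ∧
      (∀ R : Module.End ℂ (E'.fiber x), E'.HasResidue E'.Φ x R → R ≠ 0 → b = n) ∧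
      IsSectionKernel ι.toEquivHom x (LinearMap.ker (E.atFixed hx - 1)) ∧
      EvalSurjective E.toEquivBundle x (LinearMap.ker (E.atFixed hx - 1)) := by

  have hf0 : orderOf f.toEquiv ≠ 0 := hf ▸ hp.ne_zero
  have hc0 : ζ ^ n ≠ 0 := pow_ne_zero _ (hζ.ne_zero hp.ne_zero)
  have hμ : ζ ^ b ≠ 1 := hζ.pow_ne_one_of_pos_of_lt (by omega) (by have := hp.pos; omega)
  obtain ⟨B, hB⟩ := exists_diagonalization (E.coord x) (E.atFixed hx) hμ h1 hζb
  -- The columns of `G` are the eigenvectors for `1` and `ζ ^ b` in the trivialization at `x`. Hence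
  -- `τ x` diagonalizes `f_E(x)`, and `z` multiplies the `ζ ^ b` direction.
  set G : (Fin 2 → ℂ) ≃ₗ[ℂ] (Fin 2 → ℂ) := B.trans (E.coord x) with hG
  have h := E.toHolBundle.isModification_hecke x G
  set ι := E.toHolBundle.heckeMap x G
  set τ : ∀ y, E.fiber y →ₗ[ℂ] (Fin 2 → ℂ) := fun y => G.symm.toLinearMap ∘ₗ E.triv x y with hτ
  have hτx : ∀ v, τ x v = B.symm v := fun v => by
    change G.symm (E.triv x x v) = _
    rw [← E.coord_apply]
    simp [hG]
  have hE : ∀ v, τ x (E.atFixed hx v) = diagMap (ζ ^ b) (τ x v) := fun v => by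
    obtain ⟨w, rfl⟩ := B.surjective v
    rw [hB, hτx, hτx, B.symm_apply_apply, B.symm_apply_apply]
  have hτi : Function.Injective (τ x) := fun v w hvw => by
    rw [hτx, hτx] at hvw
    exact B.symm.injective hvw
  have hFx : ∀ v, v ∈ E.F x ↔ τ x v 0 = 0 := fun v => by
    rw [hF, Module.End.mem_eigenspace_iff, ← hτi.eq_iff, hE, map_smul]
    refine ⟨fun h2 => ?_, fun h2 => ?_⟩
    · have h3 : τ x v 0 = ζ ^ b * τ x v 0 := congrFun h2 0
      have h4 : (1 - ζ ^ b) * τ x v 0 = 0 := by linear_combination h3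
      exact (mul_eq_zero.1 h4).resolve_left (sub_ne_zero.2 hμ.symm)
    · ext i
      fin_cases i <;> simp [h2]
  have hW1 : ∀ v, v ∈ Module.End.eigenspace (E.atFixed hx) 1 ↔ τ x v 1 = 0 := fun v => by
    rw [Module.End.mem_eigenspace_iff, one_smul, ← hτi.eq_iff, hE]
    refine ⟨fun h2 => ?_, fun h2 => ?_⟩
    · have h3 : ζ ^ b * τ x v 1 = τ x v 1 := congrFun h2 1
      have h4 : (ζ ^ b - 1) * τ x v 1 = 0 := by linear_combination h3
      exact (mul_eq_zero.1 h4).resolve_left (sub_ne_zero.2 hμ)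
    · ext i
      fin_cases i <;> simp [h2]
  have hW2 : ∀ v, v ∈ LinearMap.ker (E.atFixed hx - 1) ↔ τ x v 1 = 0 := fun v => by
    rw [← hW1, Module.End.mem_eigenspace_iff, one_smul, LinearMap.mem_ker, LinearMap.sub_apply,
      sub_eq_zero, Module.End.one_apply]
  obtain ⟨l, k, hlh, hl, hlx⟩ := h.exists_lift (E := E.toEquivBundle) hx hc0 hdf hE
  set E' := h.higgs hf0 hxD hlh hl hFx hΦ with hE'
  set φ := h.higgsHom hf0 hxD hlh hl hFx hΦ
  have hτ' : Function.Bijective ((E.toHolBundle.hecke x G).triv x x) :=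
    Function.bijective_iff_has_inverse.2
      ⟨_, h.coord'.left.self_of_nhds, h.coord'.right.self_of_nhds⟩
  have hF' : ∀ v : E'.fiber x, v ∈ E'.F x ↔ (E.toHolBundle.hecke x G).triv x x v 0 = 0 :=
    h.mem_comap_iff hFx
  -- The exponent is an integer, as `b < n` may occur.
  have hν : (ζ ^ n)⁻¹ * ζ ^ b = ζ ^ ((b : ℤ) - n) := by
    rw [zpow_sub₀ (hζ.ne_zero hp.ne_zero), zpow_natCast, zpow_natCast, div_eq_mul_inv, mul_comm]
  have hbn : ∀ h : ζ ^ b = ζ ^ n, b = n := fun h =>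
    hζ.pow_inj (by have := hp.pos; omega) (by have := hp.pos; omega) h
  have ha : ∀ v : E'.fiber x, (E.toHolBundle.hecke x G).triv x x (E'.atFixed hx v) =
      ![(E.toHolBundle.hecke x G).triv x x v 0, ((ζ ^ n)⁻¹ * k) *
        (E.toHolBundle.hecke x G).triv x x v 0 + ζ ^ ((b : ℤ) - n) *
        (E.toHolBundle.hecke x G).triv x x v 1] := fun v => by
    refine (E'.coord_atFixed hx ((E.toHolBundle.hecke x G).triv x) v).trans ((hlx v).trans ?_)
    rw [← hν]
    congr 2
    ring
  obtain ⟨q1, q2, q3, q4⟩ := eigenspaces_of_triangular hτ' ha hF'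
  obtain ⟨P, R, hP, hPΦ, hR, hRτ⟩ := h.exists_residue h.map_modHiggs hΦ
  -- `L(-x)` is realized by `det E'` itself, so the required isomorphism is the identity.
  refine ⟨E', φ, ⟨E'.toEquivBundle.det, isTwistDown_det hL φ.toEquivHom G h.bij ?_, .refl _⟩,
    h.isIsoOn_higgsHom hf0 hxD hlh hl hFx hΦ, ?_, ?_, q1, fun hne => q2 ?_, q3, q4,
    E'.isHiggs.nilpotentResidue x hxD, fun R' hR' hR0 => ?_, h.isSectionKernel hW2,
    evalSurjective _ _ _⟩
  · filter_upwards [h.diag] with y hy v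
    have h2 := congrArg G (hy v)
    exact (G.apply_symm_apply _).symm.trans h2
  · ext v
    rw [hW1]
    exact h.range_at v
  · ext v
    rw [hF']
    exact h.ker_at v
  · rw [← hν]
    intro h2
    exact hne (hbn (inv_mul_eq_one₀ hc0 |>.1 h2).symm)
  · obtain rfl : R' = R := HolBundle.HasResidue.unique hR' hR
    -- The residue has the lower left entry of `Φ` at `x` as its only possibly nonzero entry, and
    -- the weight equation can be cancelled by it.
    have hP0 : P x (Pi.single 0 1) 1 ≠ 0 := fun h2 => hR0 (LinearMap.ext fun v => hτ'.injective
      ((hRτ v).trans (by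
        rw [h2, zero_mul]
        refine Eq.trans ?_ (map_zero _).symm
        ext i
        fin_cases i <;> rfl)))
    exact hbn (mul_right_cancel₀ hP0 (E.weight_eq hx h.coord hdf hE hP hPΦ))
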